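/- **Setting.** Let $d,T,\tau,k\ge 1$ and $1\le n\le dT$ be integers, and let $\mathfrak m_0,\mathfrak m_\varepsilon,\mathfrak v_\xi,\mathfrak c_\xi,\mathfrak c_\Pi>0$. For real matrices of the same size put $\langle A,B\rangle_{\mathcal F}=\mathrm{trace}(A^*B)$ and $\|A\|_{\mathcal F}=\langle A,A\rangle_{\mathcal F}^{1/2}$. Let $\Lambda$ be a known complex $\tau\times T$ matrix, $\mathfrak m_\Lambda=\sup_{\ell,t}|\Lambda_{\ell,t}|$, and let $\mathfrak m_\Lambda(\tau)<\infty$ satisfy $$1\vee\sup_{\mathbf T\in\mathcal M_{d,\tau}(\mathbb R),\,\mathbf T\ne0}\frac{\sup_{j,t}|(\mathbf T\Lambda)_{j,t}|}{\sup_{j,\ell}|\mathbf T_{j,\ell}|}\le\mathfrak m_\Lambda(\tau).$$ Let $\mathbf T^0\in\mathcal M_{d,\tau}(\mathbb R)$ satisfy $\sup_{j,\ell}|\mathbf T^0_{j,\ell}|\le\mathfrak m_0/\mathfrak m_\Lambda(\tau)$, and let $\mathcal S_{k,\tau}\subset\mathcal M_{d,\tau}(\mathbb R)$ be a set of products $\mathbf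 U\mathbf V$ with $\mathbf U\in\mathcal M_{d,k}(\mathbb R)$, $\mathbf V\in\mathcal M_{k,\tau}(\mathbb R)$ whose entries are all bounded by $\sqrt{\mathfrak m_0/(k\,\mathfrak m_\Lambda(\tau))}$ in absolute value. The matrices $\mathbf T\Lambda$, $\mathbf T\in\mathcal S_{k,\tau}\cup\{\mathbf T^0\}$, are assumed to be real. Put $\Theta^0=\mathbf T^0\Lambda$. One observes $\mathbf X_1,\dots,\mathbf X_n$ and $$Y_i=\mathrm{trace}(\mathbf X_i^*(\Theta^0+\varepsilon))+\xi_i,\qquad i=1,\dots,n,$$ where $\mathbf X_1,\dots,\mathbf X_n,\xi_1,\dots,\xi_n$ and the random $d\times T$ matrix $\varepsilon$ are mutually independent, and: - the $\mathbf X_i$ have a common law $\Pi$ on the set of matrix units $e_{\mathbb R^d}(j)e_{\mathbb R^T}(t)^*$, and $\Pi(\{e_{\mathbb R^d}(j)e_{\mathbb R^T}(t)^*\})\le\mathfrak c_\Pi/(dT)$ for all $j,t$; - the $\xi_i$ are identically distributed and centered, with $\mathbb E(\xi_i^2)\le\mathfrak v_\xi$ and $\mathbb E(|\xi_i|^q)\le\mathfrak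 v_\xi\mathfrak c_\xi^{q-2}q!/2$ for all integers $q\ge3$; - $\sup_{j,t}|\varepsilon_{j,t}|\le\mathfrak m_\varepsilon$, and the rows of $\varepsilon$ are independent, centered and all distributed as $(\varepsilon_1,\dots,\varepsilon_T)$ for a real process $(\varepsilon_t)_{t\in\mathbb Z}$. Put $\Phi_\varepsilon=1+\sum_{i=1}^n\phi_\varepsilon(i)^{1/2}$, where $\phi_\varepsilon(i)$ is the supremum of $|\mathbb P(B)-\mathbb P(B\mid A)|$ over $t\in\mathbb Z$, $A\in\sigma(\varepsilon_h,h\le t)$ with $\mathbb P(A)\ne0$, and $B\in\sigma(\varepsilon_\ell,\ell\ge t+i)$. Let $\|A\|_{\mathcal F,\Pi}^2=\int\langle X,A\rangle_{\mathcal F}^2\,\Pi(dX)$, let $\widehat{\mathbf T}_{k,\tau}$ be a minimizer over $\mathbf T\in\mathcal S_{k,\tau}$ of $\frac1n\sum_{i=1}^n(Y_i-\langle\mathbf X_i,\mathbf T\Lambda\rangle_{\mathcal F})^2$, and let $\widehat\Theta_{k,\tau}=\widehat{\mathbf T}_{k,\tau}\Lambda$. Define $$\mathfrak c_0=4\max\{4\mathfrak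 m_0^2,\,4\mathfrak v_\xi,\,4\mathfrak m_\varepsilon^2,\,2\mathfrak m_\varepsilon^2\Phi_\varepsilon^2\mathfrak c_\Pi\},\qquad\lambda^*=(16\,\mathfrak m_0\max\{\mathfrak m_0,\mathfrak m_\varepsilon,\mathfrak c_\xi\})^{-1},$$ $$\mathfrak c_1=32(\mathfrak c_0^{-1}\wedge\lambda^*)^{-1},\qquad\mathfrak c_2=4\mathfrak m_\Lambda\bigl(\mathfrak v_\xi^{1/2}+\mathfrak v_\xi/(2\mathfrak c_\xi)+\mathfrak m_\varepsilon+3\mathfrak m_0\bigr).$$ **Theorem.** Let $\alpha\in(0,1)$. 1. If $\mathcal S_{k,\tau}$ is finite, then with probability at least $1-\alpha$, $$\|\widehat\Theta_{k,\tau}-\Theta^0\|_{\mathcal F,\Pi}^2\le3\inf_{\mathbf T\in\mathcal S_{k,\tau}}\|(\mathbf T-\mathbf T^0)\Lambda\|_{\mathcal F,\Pi}^2+\frac{\mathfrak c_1}n\log\Bigl(\frac2\alpha|\mathcal S_{k,\tau}|\Bigr).$$ 2. For general $\mathcal S_{k,\tau}$ and every $\epsilon>0$, there is a finite set $\mathcal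 S_{k,\tau}^\epsilon\subset\mathcal S_{k,\tau}$ which is an $\epsilon$-net of $\mathcal S_{k,\tau}$ for $\|\cdot\|_{\mathcal F}$ (every point of $\mathcal S_{k,\tau}$ is at distance at most $\epsilon$ of a point of $\mathcal S_{k,\tau}^\epsilon$) and such that, with probability at least $1-\alpha$, $$\|\widehat\Theta_{k,\tau}-\Theta^0\|_{\mathcal F,\Pi}^2\le3\inf_{\mathbf T\in\mathcal S_{k,\tau}}\|(\mathbf T-\mathbf T^0)\Lambda\|_{\mathcal F,\Pi}^2+\frac{\mathfrak c_1}n\log\Bigl(\frac2\alpha|\mathcal S_{k,\tau}^\epsilon|\Bigr)+\Bigl[\mathfrak c_2+8\mathfrak m_\Lambda\mathfrak c_\xi\log\Bigl(\frac1\alpha\Bigr)\Bigr]\epsilon.$$ Moreover, for every finite subset $\mathcal S_{k,\tau}^\epsilon$ of $\mathcal S_{k,\tau}$ that is an $(\epsilon/\sqrt\tau)$-net of $\mathcal S_{k,\tau}$ for $\|\cdot\|_{\mathcal F}$, the same inequality holds with probability at least $1-2\alpha$. -/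

import Mathlib

open MeasureTheory ProbabilityTheory

noncomputable section

namespace MatrixCompletion

/-- Real matrices carry the product (that is, Borel) σ-algebra of their entries. -/
instance instMeasurableSpaceMatrix {a b : ℕ} :
    MeasurableSpace (Matrix (Fin a) (Fin b) ℝ) :=
  inferInstanceAs (MeasurableSpace (Fin a → Fin b → ℝ))

/-! ### Matrices -/

/-- The Frobenius scalar product `trace (A* B)`. -/
def frobInner {a b : ℕ} (A B : Matrix (Fin a) (Fin b) ℝ) : ℝ := (A.transpose * B).trace

/-- The Frobenius norm. -/
def frobNorm {a b : ℕ} (A : Matrix (Fin a) (Fin b) ℝ) : ℝ := Real.sqrt (frobInner A A)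

/-- The largest absolute value of an entry. -/
def supAbs {a b : ℕ} (A : Matrix (Fin a) (Fin b) ℝ) : ℝ :=
  ⨆ p : Fin a × Fin b, |A p.1 p.2|

/-- The set of the matrix units `e(j) e(t)*`. -/
def matrixUnits (d T : ℕ) : Set (Matrix (Fin d) (Fin T) ℝ) :=
  {A | ∃ j t, A = Matrix.single j t 1}

/-- `‖A‖²_{F,Π} = ∫ ⟨X, A⟩² Π(dX)`, for a law `Pi` on matrices. -/
def normSqPi {d T : ℕ} (Pi : Measure (Matrix (Fin d) (Fin T) ℝ))
    (A : Matrix (Fin d) (Fin T) ℝ) : ℝ :=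
  ∫ X, frobInner X A * frobInner X A ∂Pi

/-! ### The structure matrix -/

/-- The complex matrix `U Λ`, for a real matrix `U`. -/
def trendC {d τ T : ℕ} (Lam : Matrix (Fin τ) (Fin T) ℂ) (U : Matrix (Fin d) (Fin τ) ℝ) :
    Matrix (Fin d) (Fin T) ℂ :=
  U.map (fun x : ℝ => (x : ℂ)) * Lam

/-- The matrix `U Λ` as a real matrix; it is used for those `U` such that `U Λ` is real. -/
def trend {d τ T : ℕ} (Lam : Matrix (Fin τ) (Fin T) ℂ) (U : Matrix (Fin d) (Fin τ) ℝ) :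
    Matrix (Fin d) (Fin T) ℝ :=
  (trendC Lam U).map Complex.re

/-- `m_Λ`, the largest modulus of an entry of `Λ`. -/
def mLam {τ T : ℕ} (Lam : Matrix (Fin τ) (Fin T) ℂ) : ℝ :=
  ⨆ p : Fin τ × Fin T, ‖Lam p.1 p.2‖

/-- `m` is at least `1` and at least the supremum over all real `d × τ` matrices `U ≠ 0` of
`sup |(U Λ)_{j,t}| / sup |U_{j,l}|`. -/
def IsTrendBound (d : ℕ) {τ T : ℕ} (Lam : Matrix (Fin τ) (Fin T) ℂ) (m : ℝ) : Prop :=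
  1 ≤ m ∧ ∀ (U : Matrix (Fin d) (Fin τ) ℝ) (j : Fin d) (t : Fin T),
    ‖trendC Lam U j t‖ ≤ m * supAbs U

/-- The products `U V` of a `d × k` and a `k × τ` matrix with entries bounded by
`√(m₀ / (k m_Λ(τ)))`. -/
def boundedProducts (d k τ : ℕ) (m₀ mLamTau : ℝ) : Set (Matrix (Fin d) (Fin τ) ℝ) :=
  {A | ∃ (U : Matrix (Fin d) (Fin k) ℝ) (V : Matrix (Fin k) (Fin τ) ℝ),
    (∀ j l, |U j l| ≤ Real.sqrt (m₀ / (k * mLamTau))) ∧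
    (∀ l t, |V l t| ≤ Real.sqrt (m₀ / (k * mLamTau))) ∧ A = U * V}

/-- Every point of `S` is at Frobenius distance at most `r` of a point of the finite set `N ⊆ S`. -/
def IsFrobNet {d τ : ℕ} (S : Set (Matrix (Fin d) (Fin τ) ℝ)) (r : ℝ)
    (N : Finset (Matrix (Fin d) (Fin τ) ℝ)) : Prop :=
  (N : Set (Matrix (Fin d) (Fin τ) ℝ)) ⊆ S ∧ ∀ U ∈ S, ∃ V ∈ N, frobNorm (U - V) ≤ r

/-! ### φ-mixing -/

/-- The φ-mixing coefficient of two σ-algebras. -/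
def phiCoef {Ω : Type*} [MeasurableSpace Ω] (P : Measure Ω) (𝒜 ℬ : MeasurableSpace Ω) : ℝ :=
  sSup {x : ℝ | ∃ A B : Set Ω, MeasurableSet[𝒜] A ∧ MeasurableSet[ℬ] B ∧ P A ≠ 0 ∧
    x = |P.real B - (P[|A]).real B|}

/-- The φ-mixing coefficients of a process `Z` indexed by `ℤ`. -/
def phiMixing {Ω : Type*} [MeasurableSpace Ω] (P : Measure Ω) (Z : ℤ → Ω → ℝ) (i : ℕ) : ℝ :=
  ⨆ t : ℤ, phiCoef P
    (⨆ h : {h : ℤ // h ≤ t}, MeasurableSpace.comap (Z h) inferInstance)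
    (⨆ l : {l : ℤ // t + i ≤ l}, MeasurableSpace.comap (Z l) inferInstance)

/-- `Φ = 1 + ∑_{i=1}^n φ(i)^{1/2}`. -/
def PhiSum {Ω : Type*} [MeasurableSpace Ω] (P : Measure Ω) (Z : ℤ → Ω → ℝ) (n : ℕ) : ℝ :=
  1 + ∑ i ∈ Finset.Icc 1 n, Real.sqrt (phiMixing P Z i)

/-! ### Observations, empirical risk and least-squares estimators -/

/-- The noisy entries `Y_i = trace (X_i* M) + ξ_i` of the random matrix `M = Θ⁰ + ε`. -/
def obs {Ω : Type*} {d T n : ℕ} (Theta : Matrix (Fin d) (Fin T) ℝ)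
    (eps : Ω → Matrix (Fin d) (Fin T) ℝ) (X : Fin n → Ω → Matrix (Fin d) (Fin T) ℝ)
    (xi : Fin n → Ω → ℝ) (i : Fin n) (ω : Ω) : ℝ :=
  ((X i ω).transpose * (Theta + eps ω)).trace + xi i ω

/-- The empirical risk `r_n(A) = n⁻¹ ∑ (y_i - ⟨x_i, A⟩)²`. -/
def empRisk {d T n : ℕ} (y : Fin n → ℝ) (x : Fin n → Matrix (Fin d) (Fin T) ℝ)
    (A : Matrix (Fin d) (Fin T) ℝ) : ℝ :=
  (1 / n) * ∑ i, (y i - frobInner (x i) A) ^ 2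

/-- `U` minimizes `V ↦ r_n(V Λ)` over `S`. -/
def IsLeastSquares {d τ T n : ℕ} (Lam : Matrix (Fin τ) (Fin T) ℂ)
    (S : Set (Matrix (Fin d) (Fin τ) ℝ)) (y : Fin n → ℝ)
    (x : Fin n → Matrix (Fin d) (Fin T) ℝ) (U : Matrix (Fin d) (Fin τ) ℝ) : Prop :=
  U ∈ S ∧ ∀ V ∈ S, empRisk y x (trend Lam U) ≤ empRisk y x (trend Lam V)

/-- `E|ξ|² ≤ v` and `E|ξ|^q ≤ v c^{q-2} q! / 2` for every integer `q ≥ 3`, with finite moments. -/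
def HasBernsteinMoments {Ω : Type*} [MeasurableSpace Ω] (P : Measure Ω) (xi : Ω → ℝ)
    (v c : ℝ) : Prop :=
  (Integrable (fun ω => xi ω ^ 2) P ∧ ∫ ω, xi ω ^ 2 ∂P ≤ v) ∧
  ∀ q : ℕ, 3 ≤ q → Integrable (fun ω => |xi ω| ^ q) P ∧
    ∫ ω, |xi ω| ^ q ∂P ≤ v * c ^ (q - 2) * (q.factorial : ℝ) / 2

/-! ### Constants -/

/-- `c₀ = 4 max {4 m₀², 4 v_ξ, 4 m_ε², 2 m_ε² Φ² c_Π}`. -/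
def constExp (m₀ v_xi m_eps Phi c_Pi : ℝ) : ℝ :=
  4 * max (max (4 * m₀ ^ 2) (4 * v_xi)) (max (4 * m_eps ^ 2) (2 * m_eps ^ 2 * Phi ^ 2 * c_Pi))

/-- `λ* = (16 m₀ max {m₀, m_ε, c_ξ})⁻¹`. -/
def lambdaStar (m₀ m_eps c_xi : ℝ) : ℝ := (16 * m₀ * max m₀ (max m_eps c_xi))⁻¹

/-- `c₁ = 32 (c₀⁻¹ ∧ λ*)⁻¹`. -/
def constOne (m₀ v_xi c_xi m_eps Phi c_Pi : ℝ) : ℝ :=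
  32 * (min (constExp m₀ v_xi m_eps Phi c_Pi)⁻¹ (lambdaStar m₀ m_eps c_xi))⁻¹

/-- `c₂ = 4 m_Λ (v_ξ^{1/2} + v_ξ / (2 c_ξ) + m_ε + 3 m₀)`. -/
def constTwo (m₀ v_xi c_xi m_eps m_Lam : ℝ) : ℝ :=
  4 * m_Lam * (Real.sqrt v_xi + v_xi / (2 * c_xi) + m_eps + 3 * m₀)

end MatrixCompletion

end

/-!
Write `D = Θ⁰ - U Λ` for a parameter `U`, and `R = ‖D‖²_Π`. Up to a term that does not depend on
`U`, `n` times the empirical risk of `U Λ` is the sum over `i` of the loss increments `2 (⟨X_i, ε⟩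
+ ξ_i) ⟨X_i, D⟩ + ⟨X_i, D⟩²`, each of mean `R`. The heart of the proof is the exponential
inequality `lintegral_exp_sum_lossIncr_le`: for `u = min c₀⁻¹ λ* / 8`, the exponential moments of
the deviations of this sum from `n R`, on either side and at the rate `u`, are at most `exp (n u R
/ 2)`. A union bound over a finite set `N` then compares the error and the excess empirical risk
within a factor `2` or `3 / 2` and `log (2 |N| / α) / (n u)`, and the minimality of the estimator
yields the oracle inequality, with leading constant `3` and `c₁ = 4 / u`.

For the exponential inequality, the expectation is first taken with `ε` fixed. The observations
are then independent, and `lintegral_exp_lossIncr_le` combines Bernstein's bound for `ξ_i` with a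
second-order expansion in the bounded variables `⟨X_i, ε⟩` and `⟨X_i, D⟩`. What remains of the
noise matrix is the linear form `∑ π_{j,t} ε_{j,t} D_{j,t}`, where `π` denotes the weights of `Π`.
Its rows are independent, and each row is a piece of the φ-mixing process: grouped into at most
`n` blocks of consecutive times, it is the end point of a martingale whose increments are
controlled by the mixing coefficients (`integral_exp_sum_le_of_condExp`,
`ae_abs_condExp_le_of_phi`, `integral_exp_sum_mul_process_le`).

For an infinite parameter set the union bound is taken over a net. Replacing the estimator by a
close point of the net costs a multiple of the resolution times `n⁻¹ ∑ |ξ_i|` and constants, and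
`measure_avg_abs_gt_le` bounds this average outside an event of probability `α`.
-/

namespace MatrixCompletion

/-! ### Hoeffding's inequality under weak dependence -/

/-- The chord bound for `exp` on `[-b, b]`. For `b = 0` the quotient is `0 / 0 = 0` and both sides
are `1`. -/
lemma exp_le_cosh_add_mul_sinh {b h : ℝ} (hh : |h| ≤ b) :
    Real.exp h ≤ Real.cosh b + h * (Real.sinh b / b) := by
  rcases (abs_nonneg h).trans hh |>.eq_or_lt with hb | hb
  · subst hb
    simp [abs_nonpos_iff.mp hh]
  · obtain ⟨h1, h2⟩ := abs_le.mp hh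
    have hconv := convexOn_exp.2 (Set.mem_univ (-b)) (Set.mem_univ b)
      (show 0 ≤ (b - h) / (2 * b) from div_nonneg (by linarith) (by linarith))
      (show 0 ≤ (b + h) / (2 * b) from div_nonneg (by linarith) (by linarith))
      (by field_simp; ring)
    simp only [smul_eq_mul] at hconv
    have e1 : (b - h) / (2 * b) * -b + (b + h) / (2 * b) * b = h := by field_simp; ring
    rw [e1] at hconv
    refine hconv.trans (le_of_eq ?_)
    rw [Real.cosh_eq, Real.sinh_eq]
    field_simp
    ring

/-- The chord of `exp` on `[-b, b]`, taken at `p`, is the moment generating function at `1` of the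
law of mean `p` on `{-b, b}`, so that the bound is Hoeffding's lemma for a two-point law. -/
lemma cosh_add_mul_sinh_le {b p : ℝ} (hp : |p| ≤ b) :
    Real.cosh b + p * (Real.sinh b / b) ≤ Real.exp (p + b ^ 2 / 2) := by
  rcases (abs_nonneg p).trans hp |>.eq_or_lt with hb | hb
  · subst hb
    simp [abs_nonpos_iff.mp hp]
  · obtain ⟨h1, h2⟩ := abs_le.mp hp
    set q : ℝ := (b - p) / (2 * b) with hq
    set q' : ℝ := (b + p) / (2 * b) with hq'
    have hq0 : 0 ≤ q := div_nonneg (by linarith) (by linarith)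
    have hq0' : 0 ≤ q' := div_nonneg (by linarith) (by linarith)
    have hqq : q + q' = 1 := by rw [hq, hq']; field_simp; ring
    let μ : Measure ℝ := ENNReal.ofReal q • Measure.dirac (-b) + ENNReal.ofReal q' • Measure.dirac b
    have hμ : IsProbabilityMeasure μ := ⟨by
      simp [μ, ← ENNReal.ofReal_add hq0 hq0', hqq]⟩
    have hint : ∀ f : ℝ → ℝ, ∫ x, f x ∂μ = q * f (-b) + q' * f b := by
      intro f
      have hfin : ∀ (r x : ℝ), Integrable f (ENNReal.ofReal r • Measure.dirac x) := fun r x =>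
        (integrable_dirac (by simp)).smul_measure ENNReal.ofReal_ne_top
      rw [integral_add_measure (hfin _ _) (hfin _ _)]
      simp [ENNReal.toReal_ofReal, hq0, hq0']
    have hsub := (hasSubgaussianMGF_of_mem_Icc (μ := μ) (X := id) (a := -b) (b := b)
      measurable_id.aemeasurable (by
        refine Filter.eventually_iff.mpr ?_
        simp [μ, mem_ae_iff, hb.le]
        )).mgf_le 1
    have hmean : ∫ x, id x ∂μ = p := by
      rw [hint]
      simp only [id, hq, hq']
      field_simp; ring
    rw [mgf, hint, hmean] at hsub
    have hc : ((((‖b - -b‖₊ / 2) ^ 2 : NNReal)) : ℝ) = b ^ 2 := by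
      push_cast
      rw [Real.norm_eq_abs, div_pow, sq_abs]; ring
    rw [hc] at hsub
    simp only [id, one_mul, mul_one, one_pow, sub_eq_add_neg _ p, Real.exp_add] at hsub
    rw [Real.exp_add]
    calc _ = Real.exp p *
          (q * (Real.exp (-b) * Real.exp (-p)) + q' * (Real.exp b * Real.exp (-p))) := by
          have : Real.exp p * Real.exp (-p) = 1 := by rw [← Real.exp_add]; simp
          calc _ = q * Real.exp (-b) + q' * Real.exp b := by
                rw [Real.cosh_eq, Real.sinh_eq, hq, hq']
                field_simp; ring
            _ = (Real.exp p * Real.exp (-p)) * (q * Real.exp (-b) + q' * Real.exp b) := by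
                rw [this, one_mul]
            _ = _ := by ring
      _ ≤ _ := by gcongr

section
variable {Ω : Type*} {m0 : MeasurableSpace Ω} {P : Measure Ω} [IsProbabilityMeasure P]

lemma integrable_of_ae_abs_le {H : Ω → ℝ} {b : ℝ} (hH : AEStronglyMeasurable H P)
    (h : ∀ᵐ ω ∂P, |H ω| ≤ b) : Integrable H P :=
  Integrable.of_bound hH b h

lemma integrable_exp_of_ae_abs_le {H : Ω → ℝ} {b : ℝ} (hH : AEStronglyMeasurable H P)
    (h : ∀ᵐ ω ∂P, |H ω| ≤ b) : Integrable (fun ω => Real.exp (H ω)) P := by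
  refine Integrable.of_bound (Real.continuous_exp.comp_aestronglyMeasurable hH) (Real.exp b) ?_
  filter_upwards [h] with ω hω
  rw [Real.norm_eq_abs, Real.abs_exp]
  exact Real.exp_le_exp.mpr ((le_abs_self _).trans hω)

/-- The conditional Hoeffding lemma, integrated against the `F`-measurable weight `exp G`:
replacing `H` by its conditional expectation costs a factor `exp (b ^ 2 / 2)`. -/
lemma integral_exp_add_le {F : MeasurableSpace Ω} (hF : F ≤ m0) {G H : Ω → ℝ} {b g : ℝ}
    (hG : StronglyMeasurable[F] G) (hGb : ∀ᵐ ω ∂P, |G ω| ≤ g)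
    (hH : AEStronglyMeasurable[m0] H P) (hHb : ∀ᵐ ω ∂P, |H ω| ≤ b) :
    ∫ ω, Real.exp (G ω + H ω) ∂P ≤
      Real.exp (b ^ 2 / 2) * ∫ ω, Real.exp (G ω + (P[H|F]) ω) ∂P := by
  have hG0 : AEStronglyMeasurable[m0] G P := (hG.mono hF).aestronglyMeasurable
  have hE := ae_bdd_abs_condExp_of_ae_bdd_abs (m := F) hHb
  have hHi := integrable_of_ae_abs_le hH hHb
  have hexpG : StronglyMeasurable[F] (fun ω => Real.exp (G ω)) :=
    Real.continuous_exp.comp_stronglyMeasurable hG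
  have hexpGi : Integrable (fun ω => Real.exp (G ω)) P := integrable_exp_of_ae_abs_le hG0 hGb
  have hexpGb : ∀ᵐ ω ∂P, ‖Real.exp (G ω)‖ ≤ Real.exp g := by
    filter_upwards [hGb] with ω hω
    rw [Real.norm_eq_abs, Real.abs_exp]
    exact Real.exp_le_exp.mpr ((le_abs_self _).trans hω)
  have hGHi : Integrable (fun ω => Real.exp (G ω) * H ω) P :=
    hHi.bdd_mul hexpGi.aestronglyMeasurable hexpGb
  have hGEi : Integrable (fun ω => Real.exp (G ω) * (P[H|F]) ω) P :=
    integrable_condExp.bdd_mul hexpGi.aestronglyMeasurable hexpGb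
  have hkey : ∫ ω, Real.exp (G ω) * H ω ∂P = ∫ ω, Real.exp (G ω) * (P[H|F]) ω ∂P := by
    rw [← integral_condExp hF]
    refine integral_congr_ae ?_
    exact condExp_mul_of_stronglyMeasurable_left hexpG hGHi hHi
  have habs : ∀ {K : Ω → ℝ}, (∀ᵐ ω ∂P, |K ω| ≤ b) → ∀ᵐ ω ∂P, |G ω + K ω| ≤ g + b := by
    intro K hK
    filter_upwards [hGb, hK] with ω h1 h2
    exact (abs_add_le _ _).trans (add_le_add h1 h2)
  have hsplit : ∀ {K : Ω → ℝ}, Integrable (fun ω => Real.exp (G ω) * K ω) P →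
      Integrable (fun ω => Real.exp (G ω) * Real.cosh b +
        Real.exp (G ω) * K ω * (Real.sinh b / b)) P ∧
      ∫ ω, (Real.exp (G ω) * Real.cosh b + Real.exp (G ω) * K ω * (Real.sinh b / b)) ∂P
      = (∫ ω, Real.exp (G ω) ∂P) * Real.cosh b +
        (∫ ω, Real.exp (G ω) * K ω ∂P) * (Real.sinh b / b) := by
    intro K hK
    refine ⟨(hexpGi.mul_const _).add (hK.mul_const _), ?_⟩
    rw [integral_add (hexpGi.mul_const _) (hK.mul_const _), integral_mul_const, integral_mul_const]
  calc ∫ ω, Real.exp (G ω + H ω) ∂P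
      ≤ ∫ ω, (Real.exp (G ω) * Real.cosh b + Real.exp (G ω) * H ω * (Real.sinh b / b)) ∂P := by
        refine integral_mono_ae (integrable_exp_of_ae_abs_le (hG0.add hH) (habs hHb))
          (hsplit hGHi).1 ?_
        filter_upwards [hHb] with ω hω
        rw [Real.exp_add]
        have := mul_le_mul_of_nonneg_left (exp_le_cosh_add_mul_sinh hω) (Real.exp_pos (G ω)).le
        linarith
    _ = ∫ ω, (Real.exp (G ω) * Real.cosh b +
          Real.exp (G ω) * (P[H|F]) ω * (Real.sinh b / b)) ∂P := by
        rw [(hsplit hGHi).2, (hsplit hGEi).2, hkey]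
    _ ≤ ∫ ω, Real.exp (b ^ 2 / 2) * Real.exp (G ω + (P[H|F]) ω) ∂P := by
        refine integral_mono_ae (hsplit hGEi).1 ((integrable_exp_of_ae_abs_le
          (hG0.add integrable_condExp.aestronglyMeasurable) (habs hE)).const_mul _) ?_
        filter_upwards [hE] with ω hω
        have := mul_le_mul_of_nonneg_left (cosh_add_mul_sinh_le hω) (Real.exp_pos (G ω)).le
        rw [Real.exp_add] at this ⊢
        linarith
    _ = _ := integral_const_mul _ _

/-- Azuma–Hoeffding for weakly dependent summands: if the conditional expectation of `W l` given
`F (k + 1)` is at most `g (l - k) * A l`, the `k`-th increment of the Doob martingale of `∑ W` is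
the centering of a variable bounded by `A k + ∑_{l > k} g (l - k) * A l`. The σ-algebra `F 0` is
trivial and `F (k + 1)` is the one in which `W k` is known. -/
lemma integral_exp_sum_le_of_condExp (F : ℕ → MeasurableSpace Ω) (hF : ∀ k, F k ≤ m0)
    (hF0 : F 0 = ⊥) (hmono : Monotone F)
    (K : ℕ) (W : ℕ → Ω → ℝ) (hW : ∀ k, StronglyMeasurable[F (k + 1)] (W k))
    (A : ℕ → ℝ) (hWA : ∀ k, ∀ᵐ ω ∂P, |W k ω| ≤ A k) (hW0 : ∀ k, ∫ ω, W k ω ∂P = 0)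
    (g : ℕ → ℝ) (hg : ∀ i, 0 ≤ g i)
    (hmix : ∀ k l, k < l → ∀ᵐ ω ∂P, |(P[W l|F (k + 1)]) ω| ≤ g (l - k) * A l) :
    ∫ ω, Real.exp (∑ k ∈ Finset.range K, W k ω) ∂P ≤
      Real.exp ((∑ k ∈ Finset.range K,
        (A k + ∑ l ∈ Finset.Ico (k + 1) K, g (l - k) * A l) ^ 2) / 2) := by
  have hWm : ∀ k, AEStronglyMeasurable (W k) P := fun k =>
    ((hW k).mono (hF _)).aestronglyMeasurable
  have hWi : ∀ k, Integrable (W k) P := fun k => integrable_of_ae_abs_le (hWm k) (hWA k)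
  have hA : ∀ k, 0 ≤ A k := fun k => by
    obtain ⟨ω, hω⟩ := (hWA k).exists
    exact (abs_nonneg _).trans hω
  set b : ℕ → ℝ := fun k => A k + ∑ l ∈ Finset.Ico (k + 1) K, g (l - k) * A l with hb
  have hb0 : ∀ k, 0 ≤ b k := fun k =>
    add_nonneg (hA k) (Finset.sum_nonneg fun l _ => mul_nonneg (hg _) (hA l))
  -- the Doob martingale of `∑ W`
  set M : ℕ → Ω → ℝ := fun k ω => ∑ l ∈ Finset.range k, W l ω +
    ∑ l ∈ Finset.Ico k K, (P[W l|F k]) ω with hM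
  have key : ∀ k ≤ K, ∫ ω, Real.exp (M k ω) ∂P ≤
      Real.exp ((∑ i ∈ Finset.range k, b i ^ 2) / 2) := by
    intro k
    induction k with
    | zero =>
      intro _
      have : ∀ ω, M 0 ω = 0 := by
        intro ω
        simp [hM, hF0, condExp_bot, hW0]
      simp [this]
    | succ k ih =>
      intro hk
      set H : Ω → ℝ := fun ω => W k ω + ∑ l ∈ Finset.Ico (k + 1) K, (P[W l|F (k + 1)]) ω with hH
      set G : Ω → ℝ := fun ω => ∑ l ∈ Finset.range k, W l ω with hG
      have hHi : Integrable H P :=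
        (hWi k).add (integrable_finsetSum _ fun l _ => integrable_condExp)
      have hGm : StronglyMeasurable[F k] G := by
        refine Finset.stronglyMeasurable_fun_sum _ fun l hl => (hW l).mono (hmono ?_)
        exact Finset.mem_range.mp hl
      have hGb : ∀ᵐ ω ∂P, |G ω| ≤ ∑ l ∈ Finset.range k, A l := by
        filter_upwards [ae_all_iff.mpr hWA] with ω hω
        exact (Finset.abs_sum_le_sum_abs _ _).trans (Finset.sum_le_sum fun l _ => hω l)
      have hHb : ∀ᵐ ω ∂P, |H ω| ≤ b k := by
        have h2 : ∀ᵐ ω ∂P, ∀ l, k < l → |(P[W l|F (k + 1)]) ω| ≤ g (l - k) * A l := by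
          rw [ae_all_iff]; intro l
          rw [Filter.eventually_imp_distrib_left]
          exact fun h => hmix k l h
        filter_upwards [hWA k, h2] with ω h1 h2
        refine (abs_add_le _ _).trans (add_le_add h1 ?_)
        refine (Finset.abs_sum_le_sum_abs _ _).trans (Finset.sum_le_sum fun l hl => h2 l ?_)
        exact (Finset.mem_Ico.mp hl).1
      have h1 : ∀ ω, M (k + 1) ω = G ω + H ω := by
        intro ω
        simp only [hM, hG, hH, Finset.sum_range_succ]
        ring
      have h2 : (fun ω => G ω + (P[H|F k]) ω) =ᵐ[P] M k := by
        have e1 : P[H|F k] =ᵐ[P] P[W k|F k] + P[fun ω => ∑ l ∈ Finset.Ico (k + 1) K,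
            (P[W l|F (k + 1)]) ω|F k] :=
          condExp_add (hWi k) (integrable_finsetSum _ fun l _ => integrable_condExp) _
        have e2 : P[fun ω => ∑ l ∈ Finset.Ico (k + 1) K, (P[W l|F (k + 1)]) ω|F k] =ᵐ[P]
            ∑ l ∈ Finset.Ico (k + 1) K, P[P[W l|F (k + 1)]|F k] := by
          have := condExp_finsetSum (μ := P) (s := Finset.Ico (k + 1) K)
            (f := fun l => P[W l|F (k + 1)]) (fun l _ => integrable_condExp) (F k)
          refine Filter.EventuallyEq.trans (Filter.EventuallyEq.of_eq ?_) this
          congr 1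
          ext ω; simp
        have e3 : ∀ᵐ ω ∂P, ∀ l, (P[P[W l|F (k + 1)]|F k]) ω = (P[W l|F k]) ω := by
          rw [ae_all_iff]; intro l
          exact condExp_condExp_of_le (hmono (Nat.le_succ k)) (hF _)
        filter_upwards [e1, e2, e3] with ω h1 h2 h3
        rw [h1, Pi.add_apply, h2]
        simp only [Finset.sum_apply, h3, hM, hG]
        rw [← Finset.sum_eq_sum_Ico_succ_bot (by omega) (fun l => (P[W l|F k]) ω)]
      calc ∫ ω, Real.exp (M (k + 1) ω) ∂P = ∫ ω, Real.exp (G ω + H ω) ∂P := by simp only [h1]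
        _ ≤ Real.exp (b k ^ 2 / 2) * ∫ ω, Real.exp (G ω + (P[H|F k]) ω) ∂P :=
            integral_exp_add_le (hF k) hGm hGb hHi.aestronglyMeasurable hHb
        _ = Real.exp (b k ^ 2 / 2) * ∫ ω, Real.exp (M k ω) ∂P := by
            congr 1
            exact integral_congr_ae (h2.mono fun ω h => by simp only [h])
        _ ≤ Real.exp (b k ^ 2 / 2) * Real.exp ((∑ i ∈ Finset.range k, b i ^ 2) / 2) := by
            gcongr; exact ih (by omega)
        _ = _ := by
            rw [← Real.exp_add, Finset.sum_range_succ]; congr 1; ring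
  have := key K le_rfl
  simpa [hM] using this

/-- A centered variable bounded by `A` that depends on a `φ`-mixing future has conditional
expectation at most `2 φ A` given the past: conditioned on an event of `F`, its mean is read off
the layer-cake formula on `(0, 2 A]`, where each tail probability moves by at most `φ`. -/
lemma ae_abs_condExp_le_of_phi {F 𝒢 : MeasurableSpace Ω} (hF : F ≤ m0) (h𝒢 : 𝒢 ≤ m0)
    {W : Ω → ℝ} {A φ : ℝ} (hA : 0 ≤ A) (hW : StronglyMeasurable[𝒢] W)
    (hWA : ∀ᵐ ω ∂P, |W ω| ≤ A) (hW0 : ∫ ω, W ω ∂P = 0)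
    (hφ : ∀ S B : Set Ω, MeasurableSet[F] S → MeasurableSet[𝒢] B → P S ≠ 0 →
      |P.real B - (P[|S]).real B| ≤ φ) :
    ∀ᵐ ω ∂P, |(P[W|F]) ω| ≤ 2 * φ * A := by
  have hφ0 : 0 ≤ φ := (abs_nonneg _).trans (hφ Set.univ ∅ MeasurableSet.univ MeasurableSet.empty
    (by simp))
  have hWm : AEStronglyMeasurable[m0] W P := (hW.mono h𝒢).aestronglyMeasurable
  have hWi : Integrable W P := integrable_of_ae_abs_le hWm hWA
  -- the mean of `W` conditioned on an event of `F`
  have hcond : ∀ S, MeasurableSet[F] S → P S ≠ 0 → |∫ ω, W ω ∂(P[|S])| ≤ 2 * φ * A := by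
    intro S hS hPS
    have hprob : IsProbabilityMeasure (P[|S]) := cond_isProbabilityMeasure hPS
    have hac : P[|S] ≪ P := cond_absolutelyContinuous
    have hlc : ∀ (Q : @Measure Ω m0) [IsProbabilityMeasure Q], Q ≪ P →
        ∫ ω, W ω ∂Q + A = ∫ t in Set.Ioc 0 (2 * A), Q.real {ω | t ≤ W ω + A} := by
      intro Q _ hQ
      have hQA : ∀ᵐ ω ∂Q, |W ω| ≤ A := hQ.ae_le hWA
      have hQm : AEStronglyMeasurable[m0] W Q := (hW.mono h𝒢).aestronglyMeasurable
      have hQi : Integrable W Q := integrable_of_ae_abs_le hQm hQA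
      have h1 : ∫ ω, (W ω + A) ∂Q = ∫ ω, W ω ∂Q + A := by
        rw [integral_add hQi (integrable_const _)]; simp
      rw [← h1]
      refine @Integrable.integral_eq_integral_Ioc_meas_le Ω m0 Q (fun ω => W ω + A) (2 * A)
        (hQi.add (integrable_const _)) ?_ ?_
      · filter_upwards [hQA] with ω hω
        have := (abs_le.mp hω).1
        simp only [Pi.zero_apply]; linarith
      · filter_upwards [hQA] with ω hω
        have := (abs_le.mp hω).2
        linarith
    have hion : ∀ (Q : @Measure Ω m0) [IsProbabilityMeasure Q],
        IntegrableOn (fun t : ℝ => Q.real {ω | t ≤ W ω + A}) (Set.Ioc 0 (2 * A)) := by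
      intro Q _
      have hanti : Antitone (fun t : ℝ => Q.real {ω | t ≤ W ω + A}) := fun s t hst =>
        measureReal_mono fun ω (hω : t ≤ W ω + A) => hst.trans hω
      refine Measure.integrableOn_of_bounded (M := 1) (by simp [ENNReal.mul_eq_top])
        hanti.measurable.aestronglyMeasurable ?_
      exact Filter.Eventually.of_forall fun t => by
        rw [Real.norm_of_nonneg measureReal_nonneg]; exact measureReal_le_one
    have h1 := hlc P Measure.AbsolutelyContinuous.rfl
    have h2 := hlc (P[|S]) hac
    rw [hW0, zero_add] at h1
    have h3 : ∫ ω, W ω ∂(P[|S]) = -∫ t in Set.Ioc 0 (2 * A),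
        (P.real {ω | t ≤ W ω + A} - (P[|S]).real {ω | t ≤ W ω + A}) := by
      rw [integral_sub (hion P) (hion _)]; linarith
    rw [h3, abs_neg, ← Real.norm_eq_abs]
    refine (norm_setIntegral_le_of_norm_le_const (C := φ)
      (by simp [ENNReal.mul_lt_top_iff]) fun t _ => ?_).trans ?_
    · rw [Real.norm_eq_abs]
      refine hφ S _ hS ?_ hPS
      have : Measurable[𝒢] W := hW.measurable
      exact (this.add_const A) measurableSet_Ici
    · rw [Real.volume_real_Ioc_of_le (by linarith)]; linarith
  have hset : ∀ S, MeasurableSet[F] S → |∫ ω in S, W ω ∂P| ≤ 2 * φ * A * P.real S := by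
    intro S hS
    rcases eq_or_ne (P S) 0 with hPS | hPS
    · rw [Measure.restrict_eq_zero.mpr hPS]; simp [measureReal_def, hPS]
    · have hpos : 0 < P.real S := ENNReal.toReal_pos hPS (measure_ne_top _ _)
      have := hcond S hS hPS
      rw [ProbabilityTheory.cond, integral_smul_measure, ENNReal.toReal_inv, smul_eq_mul, abs_mul,
        abs_of_nonneg (by positivity)] at this
      rw [← measureReal_def, inv_mul_le_iff₀ hpos] at this
      linarith
  have hint : ∀ c : ℝ, Integrable (fun _ => c) (P.trim hF) := fun c => integrable_const _
  have hci : Integrable (P[W|F]) (P.trim hF) :=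
    integrable_condExp.trim hF stronglyMeasurable_condExp
  have hval : ∀ S, MeasurableSet[F] S → ∫ ω in S, (P[W|F]) ω ∂(P.trim hF) = ∫ ω in S, W ω ∂P := by
    intro S hS
    rw [← setIntegral_trim hF stronglyMeasurable_condExp hS, setIntegral_condExp hF hWi hS]
  have hcst : ∀ S, MeasurableSet[F] S → ∀ c : ℝ,
      ∫ _ in S, c ∂(P.trim hF) = c * P.real S := by
    intro S hS c
    rw [setIntegral_const, measureReal_def, trim_measurableSet_eq hF hS, smul_eq_mul, mul_comm]
    rfl
  have hle : P[W|F] ≤ᵐ[P.trim hF] fun _ => 2 * φ * A := by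
    refine ae_le_of_forall_setIntegral_le hci (hint _) fun S hS _ => ?_
    rw [hval S hS, hcst S hS]
    exact (le_abs_self _).trans (hset S hS)
  have hge : (fun _ => -(2 * φ * A)) ≤ᵐ[P.trim hF] P[W|F] := by
    refine ae_le_of_forall_setIntegral_le (hint _) hci fun S hS _ => ?_
    rw [hval S hS, hcst S hS]
    linarith [(abs_le.mp (hset S hS)).1]
  filter_upwards [ae_le_of_ae_le_trim hle, ae_le_of_ae_le_trim hge] with ω h1 h2
  exact abs_le.mpr ⟨h2, h1⟩
end

/-! ### Linear forms of φ-mixing processes -/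

/-- Schur's test for the upper triangular Toeplitz matrix with entries `1` on the diagonal and `g
(l - k)` above it. -/
lemma sum_sq_add_sum_shift_le {K n : ℕ} (hK : K ≤ n + 1) (A g : ℕ → ℝ) (hg : ∀ i, 0 ≤ g i) :
    ∑ k ∈ Finset.range K, (A k + ∑ l ∈ Finset.Ico (k + 1) K, g (l - k) * A l) ^ 2 ≤
      (1 + ∑ i ∈ Finset.Icc 1 n, g i) ^ 2 * ∑ k ∈ Finset.range K, A k ^ 2 := by
  set c : ℝ := ∑ i ∈ Finset.Icc 1 n, g i with hc
  have hc0 : 0 ≤ c := Finset.sum_nonneg fun i _ => hg i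
  have hrow : ∀ k < K, ∑ l ∈ Finset.Ico (k + 1) K, g (l - k) ≤ c := by
    intro k _
    rw [← Finset.sum_image (s := Finset.Ico (k + 1) K) (g := fun l => l - k) (f := g)]
    · refine Finset.sum_le_sum_of_subset_of_nonneg ?_ fun i _ _ => hg i
      intro i hi
      simp only [Finset.mem_image, Finset.mem_Ico, Finset.mem_Icc] at hi ⊢
      omega
    · intro x hx y hy h
      simp only [Finset.coe_Ico, Set.mem_Ico] at hx hy h
      omega
  have hcol : ∀ l < K, ∑ k ∈ Finset.range l, g (l - k) ≤ c := by
    intro l _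
    rw [← Finset.sum_image (s := Finset.range l) (g := fun k => l - k) (f := g)]
    · refine Finset.sum_le_sum_of_subset_of_nonneg ?_ fun i _ _ => hg i
      intro i hi
      simp only [Finset.mem_image, Finset.mem_range, Finset.mem_Icc] at hi ⊢
      omega
    · intro x hx y hy h
      simp only [Finset.coe_range, Set.mem_Iio] at hx hy h
      omega
  have hsq : ∀ k < K, (A k + ∑ l ∈ Finset.Ico (k + 1) K, g (l - k) * A l) ^ 2 ≤
      (1 + c) * (A k ^ 2 + ∑ l ∈ Finset.Ico (k + 1) K, g (l - k) * A l ^ 2) := by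
    intro k hk
    set q := ∑ l ∈ Finset.Ico (k + 1) K, g (l - k) * A l ^ 2 with hq
    have hq0 : 0 ≤ q := Finset.sum_nonneg fun l _ => mul_nonneg (hg _) (sq_nonneg _)
    set p := ∑ l ∈ Finset.Ico (k + 1) K, g (l - k) * A l with hp
    have hCS : p ^ 2 ≤ c * q := by
      refine (Finset.sum_sq_le_sum_mul_sum_of_sq_le_mul _ (fun l _ => hg (l - k))
        (fun l _ => mul_nonneg (hg (l - k)) (sq_nonneg (A l))) (fun l _ => le_of_eq (by ring))).trans ?_
      exact mul_le_mul_of_nonneg_right (hrow k hk) hq0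
    rcases hc0.eq_or_lt with h0 | h0
    · rw [← h0] at hCS ⊢
      have : p = 0 := pow_eq_zero_iff two_ne_zero |>.mp (le_antisymm (by linarith) (sq_nonneg p))
      rw [this]; linarith
    · have h2 : 2 * A k * p ≤ c * A k ^ 2 + q := by
        have h3 : p ^ 2 / c ≤ q := by rw [div_le_iff₀ h0]; linarith
        have h4 : 2 * A k * p ≤ c * A k ^ 2 + p ^ 2 / c := by
          have := mul_nonneg h0.le (sq_nonneg (A k - p / c))
          have e : c * (A k - p / c) ^ 2 = c * A k ^ 2 - 2 * A k * p + p ^ 2 / c := by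
            field_simp; ring
          linarith
        linarith
      nlinarith
  calc _ ≤ ∑ k ∈ Finset.range K,
        (1 + c) * (A k ^ 2 + ∑ l ∈ Finset.Ico (k + 1) K, g (l - k) * A l ^ 2) :=
        Finset.sum_le_sum fun k hk => hsq k (Finset.mem_range.mp hk)
    _ = (1 + c) * (∑ k ∈ Finset.range K, A k ^ 2 +
          ∑ l ∈ Finset.range K, (∑ k ∈ Finset.range l, g (l - k)) * A l ^ 2) := by
        rw [← Finset.mul_sum, Finset.sum_add_distrib]
        congr 2
        simp_rw [Finset.sum_mul]
        refine Finset.sum_comm' fun k l => ?_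
        simp only [Finset.mem_range, Finset.mem_Ico]
        omega
    _ ≤ (1 + c) * (∑ k ∈ Finset.range K, A k ^ 2 + ∑ l ∈ Finset.range K, c * A l ^ 2) := by
        gcongr with l hl
        exact hcol l (Finset.mem_range.mp hl)
    _ = _ := by rw [← Finset.mul_sum]; ring

section
variable {Ω : Type*} {m0 : MeasurableSpace Ω} {P : Measure Ω} [IsProbabilityMeasure P]

lemma abs_real_sub_cond_le_phiCoef {𝒜 ℬ : MeasurableSpace Ω} {A B : Set Ω}
    (hA : MeasurableSet[𝒜] A) (hB : MeasurableSet[ℬ] B) (hPA : P A ≠ 0) :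
    |P.real B - (P[|A]).real B| ≤ @phiCoef Ω m0 P 𝒜 ℬ := by
  refine le_csSup ⟨1, ?_⟩ ⟨A, B, hA, hB, hPA, rfl⟩
  rintro x ⟨A, B, -, -, hPA, rfl⟩
  have := cond_isProbabilityMeasure hPA
  have h1 : P.real B ≤ 1 := measureReal_le_one
  have h2 : (P[|A]).real B ≤ 1 := measureReal_le_one
  have h3 : 0 ≤ P.real B := measureReal_nonneg
  have h4 : 0 ≤ (P[|A]).real B := measureReal_nonneg
  rw [abs_le]; constructor <;> linarith

lemma phiCoef_le_one (𝒜 ℬ : MeasurableSpace Ω) : @phiCoef Ω m0 P 𝒜 ℬ ≤ 1 := by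
  refine Real.sSup_le ?_ zero_le_one
  rintro x ⟨A, B, -, -, hPA, rfl⟩
  have := cond_isProbabilityMeasure hPA
  have h1 : P.real B ≤ 1 := measureReal_le_one
  have h2 : (P[|A]).real B ≤ 1 := measureReal_le_one
  have h3 : 0 ≤ P.real B := measureReal_nonneg
  have h4 : 0 ≤ (P[|A]).real B := measureReal_nonneg
  rw [abs_le]; constructor <;> linarith

lemma phiMixing_le_one (Z : ℤ → Ω → ℝ) (i : ℕ) : phiMixing P Z i ≤ 1 :=
  ciSup_le fun _ => phiCoef_le_one _ _

lemma phiCoef_le_phiMixing (Z : ℤ → Ω → ℝ) (i : ℕ) (t : ℤ) :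
    phiCoef P (⨆ h : {h : ℤ // h ≤ t}, MeasurableSpace.comap (Z h) inferInstance)
      (⨆ l : {l : ℤ // t + i ≤ l}, MeasurableSpace.comap (Z l) inferInstance) ≤
    phiMixing P Z i :=
  le_ciSup (f := fun t : ℤ => phiCoef P
    (⨆ h : {h : ℤ // h ≤ t}, MeasurableSpace.comap (Z h) inferInstance)
    (⨆ l : {l : ℤ // t + i ≤ l}, MeasurableSpace.comap (Z l) inferInstance))
    ⟨1, by rintro _ ⟨t, rfl⟩; exact phiCoef_le_one _ _⟩ t

lemma phiMixing_nonneg (Z : ℤ → Ω → ℝ) (i : ℕ) : 0 ≤ phiMixing P Z i := by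
  refine le_trans ?_ (phiCoef_le_phiMixing Z i 0)
  refine (abs_nonneg _).trans (abs_real_sub_cond_le_phiCoef (A := Set.univ) (B := Set.univ)
    MeasurableSet.univ MeasurableSet.univ (by simp))

/-- Hoeffding's inequality for a linear form of a φ-mixing process. The times are grouped into at
most `n` blocks of length `L = T / n + 1`. Blocks `k < l` are at least `l - k` apart in time, so
only the coefficients up to the index `n` occur, even if `T > n`; the price is the factor `L`. As
`φ ≤ 1`, the bound `2 φ` for the conditional means is at most `2 √φ`, and Schur's test gives the
constant `(1 + ∑ 2 √φ(i))² ≤ (2 Φ)²`. -/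
lemma integral_exp_sum_mul_process_le {Z : ℤ → Ω → ℝ} (hZ : ∀ t, Measurable (Z t)) {T n : ℕ}
    (hn : 1 ≤ n) {m : ℝ} (hm : 0 ≤ m) (hZm : ∀ t : Fin T, ∀ᵐ ω ∂P, |Z ((t : ℤ) + 1) ω| ≤ m)
    (hZ0 : ∀ t : Fin T, ∫ ω, Z ((t : ℤ) + 1) ω ∂P = 0) (a : Fin T → ℝ) :
    ∫ ω, Real.exp (∑ t, a t * Z ((t : ℤ) + 1) ω) ∂P ≤
      Real.exp (2 * PhiSum P Z n ^ 2 * m ^ 2 * ((T / n + 1 : ℕ) : ℝ) * ∑ t, a t ^ 2) := by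
  classical
  set L : ℕ := T / n + 1 with hL
  have hL1 : 1 ≤ L := Nat.le_add_left 1 _
  have hTL : T < n * L := by
    exact Nat.lt_mul_div_succ T hn
  set s : ℕ → Finset (Fin T) := fun k => Finset.univ.filter fun t => (t : ℕ) / L = k with hs
  set W : ℕ → Ω → ℝ := fun k ω => ∑ t ∈ s k, a t * Z ((t : ℤ) + 1) ω with hW
  set A : ℕ → ℝ := fun k => m * ∑ t ∈ s k, |a t| with hA
  set F : ℕ → MeasurableSpace Ω := fun k => if k = 0 then ⊥ else
    ⨆ h : {h : ℤ // h ≤ (k : ℤ) * L}, MeasurableSpace.comap (Z h) inferInstance with hF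
  have hFs : ∀ k, F (k + 1) =
      ⨆ h : {h : ℤ // h ≤ ((k + 1 : ℕ) : ℤ) * L}, MeasurableSpace.comap (Z h) inferInstance :=
    fun k => by simp [hF]
  have hblock : ∀ k, ∀ t ∈ s k, k * L ≤ t ∧ (t : ℕ) + 1 ≤ (k + 1) * L := by
    intro k t ht
    have h := (Finset.mem_filter.mp ht).2
    subst h
    exact ⟨Nat.div_mul_le_self _ _, by
      have := Nat.lt_mul_div_succ t.1 hL1
      rw [mul_comm]; exact this⟩
  have hsumW : ∀ ω, ∑ k ∈ Finset.range n, W k ω = ∑ t, a t * Z ((t : ℤ) + 1) ω := by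
    intro ω
    refine Finset.sum_fiberwise_of_maps_to (fun t _ => ?_) _
    rw [Finset.mem_range, Nat.div_lt_iff_lt_mul hL1]
    exact t.2.trans hTL
  have hWA : ∀ k, ∀ᵐ ω ∂P, |W k ω| ≤ A k := by
    intro k
    filter_upwards [ae_all_iff.mpr hZm] with ω hω
    refine (Finset.abs_sum_le_sum_abs _ _).trans ?_
    simp only [hA, Finset.mul_sum]
    refine Finset.sum_le_sum fun t _ => ?_
    rw [abs_mul, mul_comm]
    exact mul_le_mul_of_nonneg_right (hω t) (abs_nonneg _)
  have hZi : ∀ t : Fin T, Integrable (Z ((t : ℤ) + 1)) P := fun t =>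
    integrable_of_ae_abs_le (hZ _).aestronglyMeasurable (hZm t)
  have hW0 : ∀ k, ∫ ω, W k ω ∂P = 0 := by
    intro k
    simp only [hW]
    rw [integral_finsetSum _ fun t _ => (hZi t).const_mul _]
    simp [integral_const_mul, hZ0]
  have hA0 : ∀ k, 0 ≤ A k := fun k =>
    mul_nonneg hm (Finset.sum_nonneg fun _ _ => abs_nonneg _)
  have hmeas : ∀ (k : ℕ) (𝒢 : MeasurableSpace Ω),
      (∀ t ∈ s k, MeasurableSpace.comap (Z ((t : ℤ) + 1)) inferInstance ≤ 𝒢) →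
      StronglyMeasurable[𝒢] (W k) := by
    intro k 𝒢 h
    refine Finset.stronglyMeasurable_fun_sum _ fun t ht => ?_
    have h1 : Measurable[𝒢] (Z ((t : ℤ) + 1)) := measurable_iff_comap_le.mpr (h t ht)
    exact (h1.stronglyMeasurable).const_mul _
  have hle : ∀ (p : ℤ → Prop), (⨆ h : {h : ℤ // p h},
      MeasurableSpace.comap (Z h) (inferInstance : MeasurableSpace ℝ)) ≤ m0 :=
    fun p => iSup_le fun h => (hZ h).comap_le
  set g : ℕ → ℝ := fun i => 2 * Real.sqrt (phiMixing P Z i) with hg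
  have hmain := integral_exp_sum_le_of_condExp (P := P) F
    (by
      intro k
      rcases k with _ | k
      · simp [hF]
      · rw [hFs]; exact hle _)
    (by simp [hF])
    (by
      refine monotone_nat_of_le_succ fun k => ?_
      rcases k with _ | k
      · simp [hF]
      · rw [hFs, hFs]
        refine iSup_le fun h => le_iSup_of_le ⟨h.1, h.2.trans ?_⟩ le_rfl
        push_cast
        nlinarith)
    n W
    (by
      intro k
      refine hmeas k _ fun t ht => ?_
      rw [hFs]
      have := (hblock k t ht).2
      exact le_iSup_of_le (⟨(t : ℤ) + 1, by exact_mod_cast this⟩ :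
        {h : ℤ // h ≤ ((k + 1 : ℕ) : ℤ) * L}) le_rfl)
    A hWA hW0 g (fun i => by positivity)
    (by
      intro k l hkl
      have hlk : ((l - k : ℕ) : ℤ) = l - k := by omega
      have h1 := ae_abs_condExp_le_of_phi (P := P) (F := F (k + 1))
        (𝒢 := ⨆ h : {h : ℤ // ((k + 1 : ℕ) : ℤ) * L + ((l - k : ℕ) : ℤ) ≤ h},
          MeasurableSpace.comap (Z h) inferInstance)
        (W := W l) (A := A l) (φ := phiMixing P Z (l - k))
        (by rw [hFs]; exact hle _) (hle _) (hA0 l)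
        (by
          refine hmeas l _ fun t ht => ?_
          have h2 := (hblock l t ht).1
          refine le_iSup_of_le (⟨(t : ℤ) + 1, ?_⟩ :
            {h : ℤ // ((k + 1 : ℕ) : ℤ) * L + ((l - k : ℕ) : ℤ) ≤ h}) le_rfl
          have h3 : (l : ℤ) * L ≤ t := by exact_mod_cast h2
          -- the start `l L + 1` of block `l` is at least `(k + 1) L + (l - k)`
          have h4 : (0 : ℤ) ≤ (l - k - 1) * (L - 1) :=
            mul_nonneg (by omega) (by omega)
          rw [hlk]
          push_cast
          nlinarith)
        (hWA l) (hW0 l)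
        (by
          intro S B hS hB hPS
          rw [hFs] at hS
          exact (abs_real_sub_cond_le_phiCoef hS hB hPS).trans (phiCoef_le_phiMixing Z _ _))
      filter_upwards [h1] with ω hω
      refine hω.trans ?_
      refine mul_le_mul_of_nonneg_right ?_ (hA0 l)
      have h0 := phiMixing_nonneg (P := P) Z (l - k)
      have := Real.le_sqrt_of_sq_le (pow_le_of_le_one h0 (phiMixing_le_one Z (l - k)) two_ne_zero)
      simp only [hg]; linarith)
  simp only [hsumW] at hmain
  refine hmain.trans (Real.exp_le_exp.mpr ?_)
  have hschur := sum_sq_add_sum_shift_le (K := n) (n := n) (by omega) A g (fun i => by positivity)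
  have hG : 1 + ∑ i ∈ Finset.Icc 1 n, g i ≤ 2 * PhiSum P Z n := by
    simp only [hg, PhiSum, ← Finset.mul_sum]; linarith
  have hcard : ∀ k, ((s k).card : ℝ) ≤ L := by
    intro k
    have h1 : ((s k).map Fin.valEmbedding) ⊆ Finset.Ico (k * L) ((k + 1) * L) := by
      intro x hx
      obtain ⟨t, ht, rfl⟩ := Finset.mem_map.mp hx
      have := hblock k t ht
      simp only [Fin.valEmbedding_apply, Finset.mem_Ico]; omega
    have h2 := Finset.card_le_card h1
    rw [Finset.card_map, Nat.card_Ico, add_mul, one_mul, Nat.add_sub_cancel_left] at h2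
    exact_mod_cast h2
  have hAA : ∑ k ∈ Finset.range n, A k ^ 2 ≤ m ^ 2 * L * ∑ t, a t ^ 2 := by
    have h1 : ∀ k, A k ^ 2 ≤ m ^ 2 * L * ∑ t ∈ s k, a t ^ 2 := by
      intro k
      have := sq_sum_le_card_mul_sum_sq (s := s k) (f := fun t => |a t|)
      simp only [sq_abs] at this
      have h2 : ((s k).card : ℝ) * ∑ t ∈ s k, a t ^ 2 ≤ L * ∑ t ∈ s k, a t ^ 2 :=
        mul_le_mul_of_nonneg_right (hcard k) (Finset.sum_nonneg fun _ _ => sq_nonneg _)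
      simp only [hA, mul_pow]
      have := mul_le_mul_of_nonneg_left (this.trans h2) (sq_nonneg m)
      linarith
    refine (Finset.sum_le_sum fun k _ => h1 k).trans (le_of_eq ?_)
    rw [← Finset.mul_sum]
    congr 1
    refine Finset.sum_fiberwise_of_maps_to (fun t _ => ?_) _
    rw [Finset.mem_range, Nat.div_lt_iff_lt_mul hL1]
    exact t.2.trans hTL
  have h0 : 0 ≤ 1 + ∑ i ∈ Finset.Icc 1 n, g i :=
    add_nonneg zero_le_one (Finset.sum_nonneg fun i _ => by positivity)
  have := mul_le_mul (pow_le_pow_left₀ h0 hG 2) hAA (Finset.sum_nonneg fun _ _ => sq_nonneg _)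
    (by positivity)
  rw [div_le_iff₀ two_pos]
  refine (hschur.trans this).trans (le_of_eq (by ring))
end

/-! ### Variables with Bernstein moments -/

lemma hasSum_exp_sub_one_sub (y : ℝ) :
    HasSum (fun q : ℕ => y ^ (q + 2) / ((q + 2).factorial : ℝ)) (Real.exp y - 1 - y) := by
  have h : HasSum (fun q : ℕ => y ^ q / (q.factorial : ℝ)) (Real.exp y) := by
    rw [Real.exp_eq_exp_ℝ]
    exact NormedSpace.expSeries_div_hasSum_exp y
  have := (hasSum_nat_add_iff' 2).mpr h
  simpa [Finset.sum_range_succ, sub_sub] using this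

lemma exp_sub_one_sub_le_abs (x : ℝ) :
    Real.exp x - 1 - x ≤ Real.exp |x| - 1 - |x| := by
  refine hasSum_le (fun q => ?_) (hasSum_exp_sub_one_sub x) (hasSum_exp_sub_one_sub |x|)
  have : x ^ (q + 2) ≤ |x| ^ (q + 2) := by rw [← abs_pow]; exact le_abs_self _
  gcongr

/-- The moment conditions, summed over the exponential series: the terms are dominated by a
geometric series of ratio `s c ≤ 1 / 2`. -/
lemma HasBernsteinMoments.lintegral_exp_le {Ω : Type*} [MeasurableSpace Ω] {P : Measure Ω}
    {xi : Ω → ℝ} {v c s : ℝ} (hxi : Measurable xi)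
    (h : HasBernsteinMoments P xi v c) (hv : 0 ≤ v) (hc : 0 ≤ c) (hs : 0 ≤ s)
    (hsc : s * c ≤ 1 / 2) :
    ∫⁻ ω, ENNReal.ofReal (Real.exp (s * |xi ω|) - 1 - s * |xi ω|) ∂P ≤
      ENNReal.ofReal (s ^ 2 * v) := by
  have hterm : ∀ q : ℕ, ∫⁻ ω, ENNReal.ofReal ((s * |xi ω|) ^ (q + 2) / ((q + 2).factorial : ℝ)) ∂P
      ≤ ENNReal.ofReal (s ^ 2 * v / 2 * (s * c) ^ q) := by
    intro q
    have hf : (0 : ℝ) < (q + 2).factorial := by positivity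
    have hmom : Integrable (fun ω => |xi ω| ^ (q + 2)) P ∧
        ∫ ω, |xi ω| ^ (q + 2) ∂P ≤ v * c ^ q * ((q + 2).factorial : ℝ) / 2 := by
      rcases q with _ | q
      · simpa using h.1
      · simpa using h.2 (q + 1 + 2) (by omega)
    have e : ∀ ω, (s * |xi ω|) ^ (q + 2) / ((q + 2).factorial : ℝ) =
        s ^ (q + 2) / ((q + 2).factorial : ℝ) * |xi ω| ^ (q + 2) := fun ω => by
      rw [mul_pow]; ring
    simp only [e]
    rw [← ofReal_integral_eq_lintegral_ofReal (hmom.1.const_mul _)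
      (Filter.Eventually.of_forall fun ω => by positivity), integral_const_mul]
    refine ENNReal.ofReal_le_ofReal ?_
    calc _ ≤ s ^ (q + 2) / ((q + 2).factorial : ℝ) * (v * c ^ q * ((q + 2).factorial : ℝ) / 2) := by
          gcongr; exact hmom.2
      _ = _ := by rw [mul_pow, pow_add]; field_simp
  have hsum : ∀ ω, ENNReal.ofReal (Real.exp (s * |xi ω|) - 1 - s * |xi ω|) =
      ∑' q : ℕ, ENNReal.ofReal ((s * |xi ω|) ^ (q + 2) / ((q + 2).factorial : ℝ)) := by
    intro ω
    have := hasSum_exp_sub_one_sub (s * |xi ω|)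
    rw [← this.tsum_eq, ENNReal.ofReal_tsum_of_nonneg (fun q => by positivity) this.summable]
  have hsc0 : 0 ≤ s * c := mul_nonneg hs hc
  have hgeo : HasSum (fun q : ℕ => s ^ 2 * v / 2 * (s * c) ^ q) (s ^ 2 * v / 2 * (1 - s * c)⁻¹) :=
    (hasSum_geometric_of_lt_one hsc0 (by linarith)).mul_left _
  simp only [hsum]
  rw [lintegral_tsum fun q => by fun_prop]
  refine (ENNReal.tsum_le_tsum hterm).trans ?_
  rw [← ENNReal.ofReal_tsum_of_nonneg (fun q => by positivity) hgeo.summable, hgeo.tsum_eq]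
  refine ENNReal.ofReal_le_ofReal ?_
  have : (1 - s * c)⁻¹ ≤ 2 := by
    rw [inv_le_comm₀ (by linarith) two_pos]; linarith
  calc s ^ 2 * v / 2 * (1 - s * c)⁻¹ ≤ s ^ 2 * v / 2 * 2 := by gcongr
    _ = _ := by ring

section
variable {Ω : Type*} [MeasurableSpace Ω] {P : Measure Ω} [IsProbabilityMeasure P]
  {xi : Ω → ℝ} {v c s : ℝ}

lemma HasBernsteinMoments.integrable_abs (hxi : Measurable xi)
    (h : HasBernsteinMoments P xi v c) : Integrable (fun ω => |xi ω|) P := by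
  have h2 : MemLp xi 2 P := (memLp_two_iff_integrable_sq hxi.aestronglyMeasurable).mpr h.1.1
  exact (h2.integrable one_le_two).abs

lemma HasBernsteinMoments.integral_abs_le (hxi : Measurable xi)
    (h : HasBernsteinMoments P xi v c) : ∫ ω, |xi ω| ∂P ≤ Real.sqrt v := by
  refine Real.le_sqrt_of_sq_le (le_trans ?_ h.1.2)
  have hi := h.integrable_abs hxi
  set μ := ∫ ω, |xi ω| ∂P with hμ
  have h0 : 0 ≤ ∫ ω, (|xi ω| - μ) ^ 2 ∂P := integral_nonneg fun ω => sq_nonneg _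
  have e : ∀ ω, (|xi ω| - μ) ^ 2 = xi ω ^ 2 - 2 * μ * |xi ω| + μ ^ 2 := fun ω => by
    rw [sub_sq, sq_abs]; ring
  simp only [e] at h0
  have h1 : Integrable (fun ω => 2 * μ * |xi ω|) P := hi.const_mul _
  have h2 : Integrable (fun ω => xi ω ^ 2 - 2 * μ * |xi ω|) P := h.1.1.sub h1
  rw [integral_add h2 (integrable_const _), integral_sub h.1.1 h1, integral_const_mul, ← hμ] at h0
  simp at h0
  linarith

lemma HasBernsteinMoments.integral_exp_abs_le (hxi : Measurable xi)
    (h : HasBernsteinMoments P xi v c) (hv : 0 ≤ v) (hc : 0 ≤ c) (hs : 0 ≤ s)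
    (hsc : s * c ≤ 1 / 2) :
    Integrable (fun ω => Real.exp (s * |xi ω|)) P ∧
    ∫ ω, (Real.exp (s * |xi ω|) - 1 - s * |xi ω|) ∂P ≤ s ^ 2 * v := by
  have hl := h.lintegral_exp_le hxi hv hc hs hsc
  have hn : ∀ ω, 0 ≤ Real.exp (s * |xi ω|) - 1 - s * |xi ω| := fun ω => by
    linarith [Real.add_one_le_exp (s * |xi ω|)]
  have hm : Measurable (fun ω => Real.exp (s * |xi ω|) - 1 - s * |xi ω|) := by fun_prop
  have hi : Integrable (fun ω => Real.exp (s * |xi ω|) - 1 - s * |xi ω|) P := by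
    refine ⟨hm.aestronglyMeasurable, ?_⟩
    rw [hasFiniteIntegral_iff_ofReal (Filter.Eventually.of_forall hn)]
    exact hl.trans_lt ENNReal.ofReal_lt_top
  refine ⟨?_, ?_⟩
  · have := (hi.add ((h.integrable_abs hxi).const_mul s)).add (integrable_const (1 : ℝ))
    refine this.congr (Filter.Eventually.of_forall fun ω => ?_)
    simp
  · rw [← ofReal_integral_eq_lintegral_ofReal hi (Filter.Eventually.of_forall hn)] at hl
    exact (ENNReal.ofReal_le_ofReal_iff (by positivity)).mp hl

/-- Bernstein's bound for the moment generating function. -/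
lemma HasBernsteinMoments.lintegral_exp_mul_le (hxi : Measurable xi)
    (h : HasBernsteinMoments P xi v c) (hmean : ∫ ω, xi ω ∂P = 0) (hv : 0 ≤ v) (hc : 0 ≤ c)
    (hsc : |s| * c ≤ 1 / 2) :
    ∫⁻ ω, ENNReal.ofReal (Real.exp (s * xi ω)) ∂P ≤ ENNReal.ofReal (Real.exp (s ^ 2 * v)) := by
  obtain ⟨h1, h2⟩ := h.integral_exp_abs_le hxi hv hc (abs_nonneg s) hsc
  have hi : Integrable xi P := (integrable_norm_iff hxi.aestronglyMeasurable).mp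
    (h.integrable_abs hxi)
  have hexp : Integrable (fun ω => Real.exp (s * xi ω)) P := by
    refine h1.mono' (by fun_prop) (Filter.Eventually.of_forall fun ω => ?_)
    rw [Real.norm_eq_abs, Real.abs_exp, ← abs_mul]
    exact Real.exp_le_exp.mpr (le_abs_self _)
  have hE : Integrable (fun ω => Real.exp (|s| * |xi ω|) - 1 - |s| * |xi ω|) P :=
    (h1.sub (integrable_const _)).sub ((h.integrable_abs hxi).const_mul _)
  rw [← ofReal_integral_eq_lintegral_ofReal hexp
    (Filter.Eventually.of_forall fun ω => (Real.exp_pos _).le)]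
  refine ENNReal.ofReal_le_ofReal ?_
  calc ∫ ω, Real.exp (s * xi ω) ∂P
      ≤ ∫ ω, ((Real.exp (|s| * |xi ω|) - 1 - |s| * |xi ω|) + (1 + s * xi ω)) ∂P := by
        refine integral_mono hexp (hE.add ((integrable_const _).add (hi.const_mul _))) fun ω => ?_
        have := exp_sub_one_sub_le_abs (s * xi ω)
        rw [abs_mul] at this
        linarith
    _ = ∫ ω, (Real.exp (|s| * |xi ω|) - 1 - |s| * |xi ω|) ∂P + 1 := by
        have h3 : Integrable (fun ω => 1 + s * xi ω) P :=
          (integrable_const _).add (hi.const_mul _)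
        rw [integral_add hE h3,
          integral_add (integrable_const _) (hi.const_mul _), integral_const_mul, hmean]
        simp
    _ ≤ s ^ 2 * v + 1 := by rw [sq_abs] at h2; linarith
    _ ≤ _ := Real.add_one_le_exp _

lemma HasBernsteinMoments.lintegral_exp_mul_abs_le (hxi : Measurable xi)
    (h : HasBernsteinMoments P xi v c) (hv : 0 ≤ v) (hc : 0 ≤ c) (hs : 0 ≤ s)
    (hsc : s * c ≤ 1 / 2) :
    ∫⁻ ω, ENNReal.ofReal (Real.exp (s * |xi ω|)) ∂P ≤
      ENNReal.ofReal (Real.exp (s * Real.sqrt v + s ^ 2 * v)) := by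
  obtain ⟨h1, h2⟩ := h.integral_exp_abs_le hxi hv hc hs hsc
  have hi := h.integrable_abs hxi
  rw [← ofReal_integral_eq_lintegral_ofReal h1
    (Filter.Eventually.of_forall fun ω => (Real.exp_pos _).le)]
  refine ENNReal.ofReal_le_ofReal ?_
  have h3 : Integrable (fun ω => Real.exp (s * |xi ω|) - 1) P := h1.sub (integrable_const _)
  rw [integral_sub h3 (hi.const_mul _),
    integral_sub h1 (integrable_const _), integral_const_mul] at h2
  simp at h2
  have h3 := mul_le_mul_of_nonneg_left (h.integral_abs_le hxi) hs
  linarith [Real.add_one_le_exp (s * Real.sqrt v + s ^ 2 * v)]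

end

/-- The Chernoff bound. -/
lemma measure_add_lt_le_of_lintegral_exp_le {Ω : Type*} [MeasurableSpace Ω] {P : Measure Ω}
    {f : Ω → ℝ} (hf : Measurable f) {K : ℝ}
    (h : ∫⁻ ω, ENNReal.ofReal (Real.exp (f ω)) ∂P ≤ ENNReal.ofReal (Real.exp K)) (l : ℝ) :
    P {ω | K + l < f ω} ≤ ENNReal.ofReal (Real.exp (-l)) := by
  calc P {ω | K + l < f ω}
      ≤ P {ω | ENNReal.ofReal (Real.exp (K + l)) ≤ ENNReal.ofReal (Real.exp (f ω))} :=
        measure_mono fun ω (hω : K + l < f ω) =>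
          ENNReal.ofReal_le_ofReal (Real.exp_le_exp.mpr hω.le)
    _ ≤ (∫⁻ ω, ENNReal.ofReal (Real.exp (f ω)) ∂P) / ENNReal.ofReal (Real.exp (K + l)) :=
        meas_ge_le_lintegral_div (by fun_prop) (by simp [Real.exp_pos]) ENNReal.ofReal_ne_top
    _ ≤ ENNReal.ofReal (Real.exp K) / ENNReal.ofReal (Real.exp (K + l)) := by gcongr
    _ = ENNReal.ofReal (Real.exp (-l)) := by
        rw [← ENNReal.ofReal_div_of_pos (Real.exp_pos _), ← Real.exp_sub]
        congr 2; ring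

/-- Upper tail of the average of the `|ξ_i|`, by Chernoff's bound at the rate `1 / (2 c)`. -/
lemma measure_avg_abs_gt_le {Ω : Type*} [MeasurableSpace Ω] {P : Measure Ω}
    [IsProbabilityMeasure P] {n : ℕ} (hn : 1 ≤ n) {xi : Fin n → Ω → ℝ}
    (hxi : ∀ i, Measurable (xi i)) (hind : iIndepFun xi P) {v c α : ℝ} (hv : 0 ≤ v) (hc : 0 < c)
    (h : ∀ i, HasBernsteinMoments P (xi i) v c) (hα : 0 < α) (hα1 : α ≤ 1) :
    P {ω | Real.sqrt v + v / (2 * c) + 2 * c * Real.log (1 / α) < (1 / n) * ∑ i, |xi i ω|} ≤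
      ENNReal.ofReal α := by
  set s : ℝ := 1 / (2 * c) with hs
  have hs0 : 0 < s := by positivity
  set t : ℝ := Real.sqrt v + v / (2 * c) + 2 * c * Real.log (1 / α) with ht
  have hn0 : (0 : ℝ) < n := by exact_mod_cast hn
  have hprod : ∫⁻ ω, ENNReal.ofReal (Real.exp (s * ∑ i, |xi i ω|)) ∂P ≤
      ENNReal.ofReal (Real.exp (n * (s * Real.sqrt v + s ^ 2 * v))) := by
    have e : ∀ ω, ENNReal.ofReal (Real.exp (s * ∑ i, |xi i ω|)) =
        ∏ i, ENNReal.ofReal (Real.exp (s * |xi i ω|)) := fun ω => by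
      rw [Finset.mul_sum, Real.exp_sum, ENNReal.ofReal_prod_of_nonneg fun i _ => (Real.exp_pos _).le]
    simp only [e]
    have hind' : iIndepFun (fun i ω => ENNReal.ofReal (Real.exp (s * |xi i ω|))) P :=
      hind.comp (fun _ x => ENNReal.ofReal (Real.exp (s * |x|))) fun _ => by fun_prop
    rw [lintegral_prod_eq_prod_lintegral_of_indepFun Finset.univ _ hind' fun i => by fun_prop]
    calc _ ≤ ∏ _i : Fin n, ENNReal.ofReal (Real.exp (s * Real.sqrt v + s ^ 2 * v)) :=
          Finset.prod_le_prod' fun i _ => (h i).lintegral_exp_mul_abs_le (hxi i) hv hc.le hs0.le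
            (by rw [hs]; field_simp; norm_num)
      _ = _ := by
          rw [Finset.prod_const, Finset.card_univ, Fintype.card_fin,
            ← ENNReal.ofReal_pow (Real.exp_pos _).le, ← Real.exp_nat_mul]
  calc P {ω | t < (1 / n) * ∑ i, |xi i ω|}
      ≤ P {ω | n * (s * Real.sqrt v + s ^ 2 * v) + n * Real.log (1 / α) <
          s * ∑ i, |xi i ω|} := by
        refine measure_mono fun ω hω => ?_
        have : t < (1 / n) * ∑ i, |xi i ω| := hω
        rw [one_div, inv_mul_eq_div, lt_div_iff₀ hn0] at this
        have e : n * (s * Real.sqrt v + s ^ 2 * v) + n * Real.log (1 / α) = s * (t * n) := by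
          rw [ht, hs]; field_simp
        exact e.trans_lt (mul_lt_mul_of_pos_left this hs0)
    _ ≤ ENNReal.ofReal (Real.exp (-(n * Real.log (1 / α)))) :=
        measure_add_lt_le_of_lintegral_exp_le (by fun_prop) hprod _
    _ = ENNReal.ofReal (α ^ n) := by
        rw [one_div, Real.log_inv, mul_neg, neg_neg, Real.exp_nat_mul, Real.exp_log hα]
    _ ≤ ENNReal.ofReal α := ENNReal.ofReal_le_ofReal
        (pow_le_of_le_one hα.le hα1 (by omega))

/-! ### Random matrix units and the loss of one observation -/

section
variable {a b : ℕ}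

lemma frobInner_eq_sum (A B : Matrix (Fin a) (Fin b) ℝ) :
    frobInner A B = ∑ j, ∑ t, A j t * B j t := by
  simp only [frobInner, Matrix.trace, Matrix.diag, Matrix.mul_apply, Matrix.transpose_apply]
  exact Finset.sum_comm

lemma frobInner_single (j : Fin a) (t : Fin b) (A : Matrix (Fin a) (Fin b) ℝ) :
    frobInner (Matrix.single j t 1) A = A j t := by
  simp [frobInner, Matrix.transpose_single, Matrix.trace_single_mul]

lemma frobInner_add_right (X A B : Matrix (Fin a) (Fin b) ℝ) :
    frobInner X (A + B) = frobInner X A + frobInner X B := by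
  simp [frobInner, Matrix.mul_add]

lemma frobInner_sub_right (X A B : Matrix (Fin a) (Fin b) ℝ) :
    frobInner X (A - B) = frobInner X A - frobInner X B := by
  simp [frobInner, Matrix.mul_sub]

lemma measurable_entry (j : Fin a) (t : Fin b) :
    Measurable fun A : Matrix (Fin a) (Fin b) ℝ => A j t :=
  (measurable_pi_apply t).comp (measurable_pi_apply (X := fun _ : Fin a => Fin b → ℝ) j)

lemma measurable_row (j : Fin a) :
    Measurable fun A : Matrix (Fin a) (Fin b) ℝ => (A j : Fin b → ℝ) :=
  measurable_pi_apply (X := fun _ : Fin a => Fin b → ℝ) j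

lemma _root_.Measurable.frobInner {α : Type*} [MeasurableSpace α]
    {f g : α → Matrix (Fin a) (Fin b) ℝ} (hf : Measurable f) (hg : Measurable g) :
    Measurable fun x => frobInner (f x) (g x) := by
  simp only [frobInner_eq_sum]
  refine Finset.measurable_fun_sum _ fun j _ => Finset.measurable_fun_sum _ fun t _ => ?_
  exact ((measurable_entry j t).comp hf).mul ((measurable_entry j t).comp hg)

instance instMeasurableSingletonClassMatrix :
    MeasurableSingletonClass (Matrix (Fin a) (Fin b) ℝ) :=
  inferInstanceAs (MeasurableSingletonClass (Fin a → Fin b → ℝ))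

/-- The matrix units as a finite set. -/
noncomputable def unitsFinset (a b : ℕ) : Finset (Matrix (Fin a) (Fin b) ℝ) :=
  Finset.univ.image fun p : Fin a × Fin b => Matrix.single p.1 p.2 1

lemma coe_unitsFinset : (unitsFinset a b : Set (Matrix (Fin a) (Fin b) ℝ)) = matrixUnits a b := by
  ext A
  simp [unitsFinset, matrixUnits, eq_comm]

lemma measurableSet_matrixUnits : MeasurableSet (matrixUnits a b) := by
  rw [← coe_unitsFinset]; exact Finset.measurableSet _

lemma single_injective : Function.Injective
    fun p : Fin a × Fin b => (Matrix.single p.1 p.2 1 : Matrix (Fin a) (Fin b) ℝ) := by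
  intro p q h
  have := congrFun (congrFun h p.1) p.2
  simp only [Matrix.single_apply, true_and] at this
  ext <;> by_contra hne <;> simp_all

lemma restrict_unitsFinset {Pi : Measure (Matrix (Fin a) (Fin b) ℝ)}
    (hPi : ∀ᵐ x ∂Pi, x ∈ matrixUnits a b) : Pi.restrict (unitsFinset a b) = Pi := by
  rw [coe_unitsFinset]; exact Measure.restrict_eq_self_of_ae_mem hPi

variable {Pi : Measure (Matrix (Fin a) (Fin b) ℝ)} [IsProbabilityMeasure Pi]

lemma integrable_of_units (hPi : ∀ᵐ x ∂Pi, x ∈ matrixUnits a b)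
    (f : Matrix (Fin a) (Fin b) ℝ → ℝ) : Integrable f Pi := by
  have : IntegrableOn f (unitsFinset a b) Pi := IntegrableOn.finset
  rwa [IntegrableOn, restrict_unitsFinset hPi] at this

lemma integral_eq_sum_units (hPi : ∀ᵐ x ∂Pi, x ∈ matrixUnits a b)
    (f : Matrix (Fin a) (Fin b) ℝ → ℝ) :
    ∫ x, f x ∂Pi = ∑ j, ∑ t, Pi.real {Matrix.single j t 1} * f (Matrix.single j t 1) := by
  have h := setIntegral_finset (μ := Pi) (f := f) (unitsFinset a b) IntegrableOn.finset
  rw [restrict_unitsFinset hPi] at h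
  rw [h, unitsFinset, Finset.sum_image single_injective.injOn, Fintype.sum_prod_type]
  simp

end

/-- The scalar product `∫ ⟨X, A⟩ ⟨X, B⟩ Π(dX)`, whose quadratic form is `normSqPi`. -/
noncomputable def innerPi {d T : ℕ} (Pi : Measure (Matrix (Fin d) (Fin T) ℝ))
    (A B : Matrix (Fin d) (Fin T) ℝ) : ℝ :=
  ∫ X, frobInner X A * frobInner X B ∂Pi

/-- The increment `(y - ⟨x, Θ - D⟩)² - (y - ⟨x, Θ⟩)²` of the squared loss at an observation `y =
⟨x, Θ + e⟩ + z`. -/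
noncomputable def lossIncr {d T : ℕ} (D e x : Matrix (Fin d) (Fin T) ℝ) (z : ℝ) : ℝ :=
  2 * (frobInner x e + z) * frobInner x D + frobInner x D ^ 2

lemma _root_.Measurable.lossIncr {d T : ℕ} {D : Matrix (Fin d) (Fin T) ℝ} {α : Type*}
    [MeasurableSpace α] {e x : α → Matrix (Fin d) (Fin T) ℝ} {z : α → ℝ} (he : Measurable e)
    (hx : Measurable x) (hz : Measurable z) :
    Measurable fun p => MatrixCompletion.lossIncr D (e p) (x p) (z p) := by
  have m3 := hx.frobInner (measurable_const (a := D))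
  exact ((((hx.frobInner he).add hz).const_mul 2).mul m3).add (m3.pow_const 2)

/-- The pointwise form of the bound for one observation: `a` is an entry of the noise matrix and
`D` one of the parameter error, and the term `(2 σ u D) ^ 2 * v` is what the integration of the
observation noise leaves in the exponent. The exponent `x` satisfies `|x| ≤ 1`, whence `exp x ≤ 1
+ x + x ^ 2`, and the terms of second order are at most `u * D ^ 2 / 4`. -/
lemma exp_increment_le {σ u m₀ me v a D : ℝ} (hσ : |σ| = 1) (hu : 0 ≤ u) (hm₀ : 0 ≤ m₀)
    (hv : 0 ≤ v) (ha : |a| ≤ me) (hD : |D| ≤ 2 * m₀)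
    (h1 : u * m₀ ^ 2 ≤ 1 / 128) (h2 : u * v ≤ 1 / 128) (h3 : u * me ^ 2 ≤ 1 / 128) :
    Real.exp (σ * u * (2 * a * D + D ^ 2) + (2 * σ * u * D) ^ 2 * v) ≤
      1 + (σ * u * (2 * a * D + D ^ 2) + u * D ^ 2 / 4) := by
  have hσ2 : σ ^ 2 = 1 := by rw [← sq_abs, hσ]; norm_num
  have hD2 : D ^ 2 ≤ 4 * m₀ ^ 2 := by
    rw [← sq_abs D]; nlinarith [abs_nonneg D]
  have ha2 : a ^ 2 ≤ me ^ 2 := by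
    rw [← sq_abs a]; exact pow_le_pow_left₀ (abs_nonneg a) ha 2
  have hD0 := sq_nonneg D
  set w := σ * u * (2 * a * D + D ^ 2) with hw
  set y := (2 * σ * u * D) ^ 2 * v with hy
  have hyle : y ≤ u * D ^ 2 / 32 := by
    have : y = 4 * (u * D ^ 2) * (u * v) := by rw [hy]; linear_combination 4 * u ^ 2 * D ^ 2 * v * hσ2
    rw [this]
    have := mul_le_mul_of_nonneg_left h2 (by positivity : 0 ≤ 4 * (u * D ^ 2))
    linarith
  have hy0 : 0 ≤ y := by positivity
  have hqu : u * D ^ 2 ≤ 1 / 32 := by nlinarith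
  have hw2 : w ^ 2 ≤ u * D ^ 2 / 8 := by
    have e : w ^ 2 = u * D ^ 2 * (u * (2 * a + D) ^ 2) := by
      rw [hw]; linear_combination u ^ 2 * (2 * a * D + D ^ 2) ^ 2 * hσ2
    have : u * (2 * a + D) ^ 2 ≤ 1 / 8 := by
      have : (2 * a + D) ^ 2 ≤ 8 * a ^ 2 + 2 * D ^ 2 := by nlinarith [sq_nonneg (2 * a - D)]
      nlinarith
    rw [e]
    have := mul_le_mul_of_nonneg_left this (by positivity : 0 ≤ u * D ^ 2)
    linarith
  have hw1 : |w| ≤ 1 / 8 := by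
    rw [← abs_of_pos (by norm_num : (0 : ℝ) < 1 / 8)]
    refine sq_le_sq.mp ?_
    linarith
  obtain ⟨hwa, hwb⟩ := abs_le.mp hw1
  have hx : |w + y| ≤ 1 := by rw [abs_le]; constructor <;> linarith
  have := (abs_le.mp (Real.norm_exp_sub_one_sub_id_le (x := w + y) hx)).2
  rw [Real.norm_eq_abs, sq_abs] at this
  have h5 : (w + y) ^ 2 ≤ u * D ^ 2 / 8 + y / 4 + y / 32 := by nlinarith
  linarith

/-- Fubini's theorem for independent random variables. -/
lemma lintegral_comp_of_indepFun {Ω α β : Type*} [MeasurableSpace Ω] [MeasurableSpace α]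
    [MeasurableSpace β] {P : Measure Ω} [IsProbabilityMeasure P] {f : Ω → α} {g : Ω → β}
    (hf : Measurable f) (hg : Measurable g) (h : IndepFun f g P) {F : α → β → ENNReal}
    (hF : Measurable (Function.uncurry F)) :
    ∫⁻ ω, F (f ω) (g ω) ∂P = ∫⁻ ω', ∫⁻ ω, F (f ω) (g ω') ∂P ∂P := by
  have : IsProbabilityMeasure (P.map f) := Measure.isProbabilityMeasure_map hf.aemeasurable
  have : IsProbabilityMeasure (P.map g) := Measure.isProbabilityMeasure_map hg.aemeasurable
  have e := h.map_prod_eq_prod_map_map hf.aemeasurable hg.aemeasurable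
  calc ∫⁻ ω, F (f ω) (g ω) ∂P = ∫⁻ p, Function.uncurry F p ∂(P.map fun ω => (f ω, g ω)) := by
        rw [lintegral_map hF (hf.prodMk hg)]; rfl
    _ = ∫⁻ y, ∫⁻ x, F x y ∂(P.map f) ∂(P.map g) := by
        rw [e, lintegral_prod_symm _ hF.aemeasurable]; rfl
    _ = ∫⁻ y, ∫⁻ ω, F (f ω) y ∂P ∂(P.map g) := by
        refine lintegral_congr fun y => ?_
        exact lintegral_map (hF.comp (measurable_id.prodMk measurable_const)) hf
    _ = _ := by
        refine lintegral_map ?_ hg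
        exact Measurable.lintegral_prod_left'
          (f := fun p : Ω × β => Function.uncurry F (f p.1, p.2))
          (hF.comp ((hf.comp measurable_fst).prodMk measurable_snd))

section
variable {Ω : Type*} [MeasurableSpace Ω] {P : Measure Ω} [IsProbabilityMeasure P] {d T : ℕ}
  {Pi : Measure (Matrix (Fin d) (Fin T) ℝ)} {D : Matrix (Fin d) (Fin T) ℝ}
  {u σ m₀ me v c : ℝ}

/-- The exponential moment of the loss increment of one observation, for a fixed noise matrix `e`.
-/
lemma lintegral_exp_lossIncr_le {X : Ω → Matrix (Fin d) (Fin T) ℝ} (hX : Measurable X)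
    (hXlaw : P.map X = Pi) (hXunit : ∀ᵐ ω ∂P, X ω ∈ matrixUnits d T)
    {xi : Ω → ℝ} (hxi : Measurable xi) (hmean : ∫ ω, xi ω ∂P = 0)
    (hmom : HasBernsteinMoments P xi v c) (hind : IndepFun X xi P)
    (hσ : |σ| = 1) (hu : 0 ≤ u) (hm₀ : 0 ≤ m₀) (hv : 0 ≤ v) (hc : 0 ≤ c)
    (h1 : u * m₀ ^ 2 ≤ 1 / 128) (h2 : u * v ≤ 1 / 128) (h3 : u * me ^ 2 ≤ 1 / 128)
    (h5 : u * (m₀ * c) ≤ 1 / 128)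
    (hD : ∀ j t, |D j t| ≤ 2 * m₀) {e : Matrix (Fin d) (Fin T) ℝ} (he : ∀ j t, |e j t| ≤ me) :
    ∫⁻ ω, ENNReal.ofReal (Real.exp (σ * u * lossIncr D e (X ω) (xi ω))) ∂P ≤
      ENNReal.ofReal (Real.exp (σ * u * (2 * innerPi Pi e D + normSqPi Pi D) +
        u * normSqPi Pi D / 4)) := by
  have hPiprob : IsProbabilityMeasure Pi := hXlaw ▸ Measure.isProbabilityMeasure_map hX.aemeasurable
  have hPi : ∀ᵐ x ∂Pi, x ∈ matrixUnits d T := by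
    rw [← hXlaw]; exact (ae_map_iff hX.aemeasurable measurableSet_matrixUnits).mpr hXunit
  set g : Matrix (Fin d) (Fin T) ℝ → ℝ := fun x => 1 +
    (σ * u * (2 * frobInner x e * frobInner x D + frobInner x D ^ 2) +
      u * frobInner x D ^ 2 / 4) with hg
  have hcond : ∀ x ∈ matrixUnits d T,
      ∫⁻ ω, ENNReal.ofReal (Real.exp (σ * u * lossIncr D e x (xi ω))) ∂P ≤
        ENNReal.ofReal (g x) := by
    rintro x ⟨j, t, rfl⟩
    set a := e j t with ha
    set D' := D j t with hD'
    have e1 : ∀ z, Real.exp (σ * u * lossIncr D e (Matrix.single j t 1) z) =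
        Real.exp (σ * u * (2 * a * D' + D' ^ 2)) * Real.exp (2 * σ * u * D' * z) := by
      intro z
      rw [← Real.exp_add, lossIncr, frobInner_single, frobInner_single]
      congr 1; ring
    simp only [e1, ENNReal.ofReal_mul (Real.exp_pos _).le]
    rw [lintegral_const_mul _ (by fun_prop)]
    have hB := hmom.lintegral_exp_mul_le (s := 2 * σ * u * D') hxi hmean hv hc (by
      rw [abs_mul, abs_mul, abs_mul, hσ, abs_of_nonneg hu, abs_two]
      have := mul_le_mul_of_nonneg_left (hD j t) (mul_nonneg hu hc)
      linarith)
    refine (mul_le_mul_right hB _).trans ?_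
    rw [← ENNReal.ofReal_mul (Real.exp_pos _).le, ← Real.exp_add]
    refine ENNReal.ofReal_le_ofReal ?_
    simp only [hg, frobInner_single]
    exact exp_increment_le hσ hu hm₀ hv (he j t) (hD j t) h1 h2 h3
  rw [lintegral_comp_of_indepFun (F := fun z x =>
    ENNReal.ofReal (Real.exp (σ * u * lossIncr D e x z))) hxi hX hind.symm
    (((measurable_const.lossIncr measurable_snd measurable_fst).const_mul _).exp.ennreal_ofReal)]
  have hg0 : ∀ᵐ x ∂Pi, 0 ≤ g x := by
    filter_upwards [hPi] with x hx
    obtain ⟨j, t, rfl⟩ := hx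
    simp only [hg, frobInner_single]
    exact (Real.exp_pos _).le.trans
      (exp_increment_le hσ hu hm₀ hv (he j t) (hD j t) h1 h2 h3)
  have hgm : Measurable g := by
    have m2 := measurable_id.frobInner (measurable_const (a := e))
    have m3 := measurable_id.frobInner (measurable_const (a := D))
    have m4 := m3.pow_const 2
    exact ((((m2.const_mul 2).mul m3).add m4).const_mul (σ * u) |>.add
      ((m4.const_mul u).div_const 4)).const_add 1
  calc _ ≤ ∫⁻ ω, ENNReal.ofReal (g (X ω)) ∂P := by
        refine lintegral_mono_ae ?_
        filter_upwards [hXunit] with ω hω using hcond _ hω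
    _ = ∫⁻ x, ENNReal.ofReal (g x) ∂Pi := by
        rw [← hXlaw, lintegral_map hgm.ennreal_ofReal hX]
    _ = ENNReal.ofReal (∫ x, g x ∂Pi) :=
        (ofReal_integral_eq_lintegral_ofReal (integrable_of_units hPi _) hg0).symm
    _ ≤ _ := by
        refine ENNReal.ofReal_le_ofReal ?_
        have I := fun f => integrable_of_units hPi f
        have e2 : ∀ x, g x = 1 + ((2 * (σ * u)) * (frobInner x e * frobInner x D) +
            (σ * u + u / 4) * (frobInner x D * frobInner x D)) := fun x => by
          simp only [hg]; ring
        have e3 : ∫ x, g x ∂Pi = 1 + ((2 * (σ * u)) * innerPi Pi e D +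
            (σ * u + u / 4) * normSqPi Pi D) := by
          simp only [e2]
          rw [integral_add (I _) (I _), integral_add (I _) (I _), integral_const_mul,
            integral_const_mul]
          simp [innerPi, normSqPi]
        rw [e3]
        refine le_trans ?_ (Real.add_one_le_exp _)
        linarith
end

/-! ### The exponential inequality -/

section
variable {Ω Ω' : Type*} [MeasurableSpace Ω] [MeasurableSpace Ω']
  {P : Measure Ω} [IsProbabilityMeasure P] {P' : Measure Ω'} [IsProbabilityMeasure P'] {d T n : ℕ}
  {Pi : Measure (Matrix (Fin d) (Fin T) ℝ)}
  {D : Matrix (Fin d) (Fin T) ℝ} {eps : Ω → Matrix (Fin d) (Fin T) ℝ} {Z : ℤ → Ω' → ℝ}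
  {u σ m₀ me v c cP : ℝ}

/-- Hoeffding's inequality for a row of the noise matrix, carried over from the process through
the equality of laws. -/
lemma lintegral_exp_row_le {y : Ω → Fin T → ℝ} (hy : Measurable y)
    (hyb : ∀ᵐ ω ∂P, ∀ t, |y ω t| ≤ me) (hy0 : ∀ t, ∫ ω, y ω t ∂P = 0)
    (hZ : ∀ t, Measurable (Z t))
    (hlaw : P.map y = P'.map (fun ω' (t : Fin T) => Z ((t : ℤ) + 1) ω'))
    (hn : 1 ≤ n) (hme : 0 ≤ me) (a : Fin T → ℝ) :
    ∫⁻ ω, ENNReal.ofReal (Real.exp (∑ t, a t * y ω t)) ∂P ≤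
      ENNReal.ofReal (Real.exp
        (2 * PhiSum P' Z n ^ 2 * me ^ 2 * ((T / n + 1 : ℕ) : ℝ) * ∑ t, a t ^ 2)) := by
  have hzm : Measurable (fun ω' (t : Fin T) => Z ((t : ℤ) + 1) ω') :=
    measurable_pi_lambda _ fun t => hZ _
  have hset : MeasurableSet {x : Fin T → ℝ | ∀ t, |x t| ≤ me} := by
    rw [Set.ofPred_forall]
    exact MeasurableSet.iInter fun t => measurableSet_le (by fun_prop) measurable_const
  have hZb : ∀ᵐ ω' ∂P', ∀ t : Fin T, |Z ((t : ℤ) + 1) ω'| ≤ me := by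
    have h1 : ∀ᵐ x ∂(P.map y), ∀ t, |x t| ≤ me := (ae_map_iff hy.aemeasurable hset).mpr hyb
    rw [hlaw] at h1
    exact (ae_map_iff hzm.aemeasurable hset).mp h1
  have hZ0 : ∀ t : Fin T, ∫ ω', Z ((t : ℤ) + 1) ω' ∂P' = 0 := by
    intro t
    have h1 := integral_map (μ := P) hy.aemeasurable
      (f := fun x : Fin T → ℝ => x t) (measurable_pi_apply t).aestronglyMeasurable
    have h2 := integral_map (μ := P') hzm.aemeasurable
      (f := fun x : Fin T → ℝ => x t) (measurable_pi_apply t).aestronglyMeasurable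
    rw [← hlaw, h1, hy0] at h2
    exact h2.symm
  have hG : Measurable fun x : Fin T → ℝ => ENNReal.ofReal (Real.exp (∑ t, a t * x t)) := by
    fun_prop
  have hi : Integrable (fun ω' => Real.exp (∑ t : Fin T, a t * Z ((t : ℤ) + 1) ω')) P' := by
    refine integrable_exp_of_ae_abs_le (b := ∑ t, |a t| * me)
      (Measurable.aestronglyMeasurable (by fun_prop)) ?_
    filter_upwards [hZb] with ω hω
    refine (Finset.abs_sum_le_sum_abs _ _).trans (Finset.sum_le_sum fun t _ => ?_)
    rw [abs_mul]
    exact mul_le_mul_of_nonneg_left (hω t) (abs_nonneg _)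
  rw [← lintegral_map hG hy, hlaw, lintegral_map hG hzm,
    ← ofReal_integral_eq_lintegral_ofReal hi
      (Filter.Eventually.of_forall fun _ => (Real.exp_pos _).le)]
  exact ENNReal.ofReal_le_ofReal
    (integral_exp_sum_mul_process_le hZ hn hme (ae_all_iff.mp hZb) hZ0 a)

/-- The conditional mean of the noise term, `∑ π_{j,t} e_{j,t} D_{j,t}`, is a sum over independent
rows of linear forms with coefficients `a = π D`. As `π ≤ c_Π / (d T)`, `∑ a² ≤ c_Π / (d T)
‖D‖²_Π`, and the block length `L = T / n + 1` satisfies `L / (d T) ≤ 2 / n` because `n ≤ d T`. -/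
lemma lintegral_exp_innerPi_le [IsProbabilityMeasure Pi] (hPi : ∀ᵐ x ∂Pi, x ∈ matrixUnits d T)
    (hPib : ∀ j t, Pi.real {Matrix.single j t (1 : ℝ)} ≤ cP / (d * T)) (hcP : 0 ≤ cP)
    (heps : Measurable eps) (hepsb : ∀ᵐ ω ∂P, ∀ j t, |eps ω j t| ≤ me)
    (heps0 : ∀ j t, ∫ ω, eps ω j t ∂P = 0)
    (hrows : iIndepFun (fun (j : Fin d) (ω : Ω) => (eps ω j : Fin T → ℝ)) P)
    (hZ : ∀ t, Measurable (Z t))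
    (hlaw : ∀ j, P.map (fun ω => (eps ω j : Fin T → ℝ)) =
      P'.map (fun ω' (t : Fin T) => Z ((t : ℤ) + 1) ω'))
    (hn : 1 ≤ n) (hd : 1 ≤ d) (hT : 1 ≤ T) (hnT : n ≤ d * T) (hme : 0 ≤ me) (s : ℝ) :
    ∫⁻ ω, ENNReal.ofReal (Real.exp (s * innerPi Pi (eps ω) D)) ∂P ≤
      ENNReal.ofReal (Real.exp
        (4 * s ^ 2 * (me ^ 2 * PhiSum P' Z n ^ 2 * cP) * normSqPi Pi D / n)) := by
  set p : Fin d → Fin T → ℝ := fun j t => Pi.real {Matrix.single j t (1 : ℝ)} with hp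
  have hinner : ∀ e, innerPi Pi e D = ∑ j, ∑ t, p j t * (e j t * D j t) := fun e => by
    rw [innerPi, integral_eq_sum_units hPi]
    simp only [frobInner_single, hp]
  have hnorm : normSqPi Pi D = ∑ j, ∑ t, p j t * (D j t * D j t) := hinner D
  set a : Fin d → Fin T → ℝ := fun j t => s * (p j t * D j t) with ha
  have e1 : ∀ ω, ENNReal.ofReal (Real.exp (s * innerPi Pi (eps ω) D)) =
      ∏ j, ENNReal.ofReal (Real.exp (∑ t, a j t * eps ω j t)) := by
    intro ω
    rw [← ENNReal.ofReal_prod_of_nonneg fun j _ => (Real.exp_pos _).le, ← Real.exp_sum, hinner,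
      Finset.mul_sum]
    congr 3; ext j
    rw [Finset.mul_sum]
    refine Finset.sum_congr rfl fun t _ => ?_
    simp only [ha]; ring
  have hG : ∀ j, Measurable fun x : Fin T → ℝ =>
      ENNReal.ofReal (Real.exp (∑ t, a j t * x t)) := fun j => by fun_prop
  have hrow : ∀ j, Measurable fun ω => (eps ω j : Fin T → ℝ) := fun j =>
    (measurable_row j).comp heps
  have hind := hrows.comp (fun j x => ENNReal.ofReal (Real.exp (∑ t, a j t * x t))) hG
  simp only [e1]
  have e2 := lintegral_prod_eq_prod_lintegral_of_indepFun Finset.univ _ hind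
    fun j => (hG j).comp (hrow j)
  simp only [Function.comp_def] at e2
  rw [e2]
  set L : ℝ := ((T / n + 1 : ℕ) : ℝ) with hL
  set Φ := PhiSum P' Z n
  have hn0 : (0 : ℝ) < n := by exact_mod_cast hn
  have hdT : (0 : ℝ) < (d : ℝ) * T := by
    have : 0 < d * T := Nat.mul_pos hd hT
    exact_mod_cast this
  have hLn : L * (n : ℝ) ≤ 2 * (d * T) := by
    have h1 : (T / n + 1) * n ≤ 2 * (d * T) := by
      have h2 := Nat.div_mul_le_self T n
      have h3 : T ≤ d * T := Nat.le_mul_of_pos_left T hd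
      rw [add_mul, one_mul]; omega
    rw [hL]; exact_mod_cast h1
  have hp0 : ∀ j t, 0 ≤ p j t := fun j t => measureReal_nonneg
  have hR0 : 0 ≤ normSqPi Pi D := by
    rw [hnorm]
    exact Finset.sum_nonneg fun j _ => Finset.sum_nonneg fun t _ =>
      mul_nonneg (hp0 j t) (mul_self_nonneg _)
  have hsum : ∑ j, ∑ t, a j t ^ 2 ≤ s ^ 2 * (cP / (d * T)) * normSqPi Pi D := by
    rw [hnorm, Finset.mul_sum]
    refine Finset.sum_le_sum fun j _ => ?_
    rw [Finset.mul_sum]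
    refine Finset.sum_le_sum fun t _ => ?_
    have h1 : a j t ^ 2 = s ^ 2 * (p j t * (D j t * D j t)) * p j t := by simp only [ha]; ring
    have h2 := mul_le_mul_of_nonneg_left (hPib j t)
      (mul_nonneg (sq_nonneg s) (mul_nonneg (hp0 j t) (mul_self_nonneg (D j t))))
    rw [h1]
    refine h2.trans (le_of_eq ?_)
    ring
  calc _ ≤ ∏ j, ENNReal.ofReal (Real.exp (2 * Φ ^ 2 * me ^ 2 * L * ∑ t, a j t ^ 2)) := by
        refine Finset.prod_le_prod' fun j _ => ?_
        refine lintegral_exp_row_le (hrow j) ?_ (heps0 j) hZ (hlaw j) hn hme (a j)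
        filter_upwards [hepsb] with ω hω using hω j
    _ = ENNReal.ofReal (Real.exp (2 * Φ ^ 2 * me ^ 2 * L * ∑ j, ∑ t, a j t ^ 2)) := by
        rw [← ENNReal.ofReal_prod_of_nonneg fun j _ => (Real.exp_pos _).le, ← Real.exp_sum,
          ← Finset.mul_sum]
    _ ≤ _ := by
        refine ENNReal.ofReal_le_ofReal (Real.exp_le_exp.mpr ?_)
        have hL0 : 0 ≤ L := by rw [hL]; positivity
        have h1 := mul_le_mul_of_nonneg_left hsum
          (by positivity : 0 ≤ 2 * Φ ^ 2 * me ^ 2 * L)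
        refine h1.trans ?_
        have h2 : L / (d * T) ≤ 2 / n := by
          rw [div_le_div_iff₀ hdT hn0]; exact hLn
        calc _ = 2 * s ^ 2 * (me ^ 2 * Φ ^ 2 * cP) * normSqPi Pi D * (L / (d * T)) := by ring
          _ ≤ 2 * s ^ 2 * (me ^ 2 * Φ ^ 2 * cP) * normSqPi Pi D * (2 / n) := by gcongr
          _ = _ := by ring

/-- The exponential inequality for the excess empirical risk. The sign `σ` selects its lower or
its upper deviations from `n * normSqPi Pi D`. Of the admitted excess `n u ‖D‖²_Π / 2`, one half
is used up by the observations given the noise matrix, the other half by the noise matrix. -/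
lemma lintegral_exp_sum_lossIncr_le
    {X : Fin n → Ω → Matrix (Fin d) (Fin T) ℝ} (hX : ∀ i, Measurable (X i))
    (hXlaw : ∀ i, P.map (X i) = Pi) (hXunit : ∀ i, ∀ᵐ ω ∂P, X i ω ∈ matrixUnits d T)
    (hPib : ∀ j t, Pi.real {Matrix.single j t (1 : ℝ)} ≤ cP / (d * T)) (hcP : 0 ≤ cP)
    {xi : Fin n → Ω → ℝ} (hxi : ∀ i, Measurable (xi i)) (hmean : ∀ i, ∫ ω, xi i ω ∂P = 0)
    (hmom : ∀ i, HasBernsteinMoments P (xi i) v c)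
    (heps : Measurable eps) (hepsb : ∀ᵐ ω ∂P, ∀ j t, |eps ω j t| ≤ me)
    (heps0 : ∀ j t, ∫ ω, eps ω j t ∂P = 0)
    (hrows : iIndepFun (fun (j : Fin d) (ω : Ω) => (eps ω j : Fin T → ℝ)) P)
    (hZ : ∀ t, Measurable (Z t))
    (hlaw : ∀ j, P.map (fun ω => (eps ω j : Fin T → ℝ)) =
      P'.map (fun ω' (t : Fin T) => Z ((t : ℤ) + 1) ω'))
    (hpair : ∀ i, IndepFun (X i) (xi i) P)
    (hpairs : iIndepFun (fun (i : Fin n) (ω : Ω) => (X i ω, xi i ω)) P)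
    (hpairs_eps : IndepFun (fun (ω : Ω) (i : Fin n) => (X i ω, xi i ω)) eps P)
    (hn : 1 ≤ n) (hd : 1 ≤ d) (hT : 1 ≤ T) (hnT : n ≤ d * T)
    (hσ : |σ| = 1) (hu : 0 ≤ u) (hme : 0 ≤ me) (hm₀ : 0 ≤ m₀) (hv : 0 ≤ v) (hc : 0 ≤ c)
    (h1 : u * m₀ ^ 2 ≤ 1 / 128) (h2 : u * v ≤ 1 / 128) (h3 : u * me ^ 2 ≤ 1 / 128)
    (h5 : u * (m₀ * c) ≤ 1 / 128) (h6 : u * (me ^ 2 * PhiSum P' Z n ^ 2 * cP) ≤ 1 / 64)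
    (hD : ∀ j t, |D j t| ≤ 2 * m₀) :
    ∫⁻ ω, ENNReal.ofReal (Real.exp (σ * u * ∑ i, lossIncr D (eps ω) (X i ω) (xi i ω))) ∂P ≤
      ENNReal.ofReal (Real.exp (n * u * (σ * normSqPi Pi D + normSqPi Pi D / 2))) := by
  have i0 : Fin n := ⟨0, hn⟩
  have hPiprob : IsProbabilityMeasure Pi :=
    hXlaw i0 ▸ Measure.isProbabilityMeasure_map (hX i0).aemeasurable
  have hPi : ∀ᵐ x ∂Pi, x ∈ matrixUnits d T := by
    rw [← hXlaw i0]
    exact (ae_map_iff (hX i0).aemeasurable measurableSet_matrixUnits).mpr (hXunit i0)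
  set R := normSqPi Pi D with hR
  have hR0 : 0 ≤ R := integral_nonneg fun x => mul_self_nonneg _
  have hn0 : (0 : ℝ) < n := by exact_mod_cast hn
  have hpm : Measurable fun (ω : Ω) (i : Fin n) => (X i ω, xi i ω) :=
    measurable_pi_lambda _ fun i => (hX i).prodMk (hxi i)
  have e1 : ∀ ω ω', ENNReal.ofReal (Real.exp (σ * u * ∑ i, lossIncr D (eps ω') (X i ω) (xi i ω)))
      = ∏ i, ENNReal.ofReal (Real.exp (σ * u * lossIncr D (eps ω') (X i ω) (xi i ω))) := by
    intro ω ω'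
    rw [Finset.mul_sum, Real.exp_sum, ENNReal.ofReal_prod_of_nonneg fun i _ => (Real.exp_pos _).le]
  -- conditionally on `ε`, the observations are independent
  have hcond : ∀ ω', (∀ j t, |eps ω' j t| ≤ me) →
      ∫⁻ ω, ENNReal.ofReal (Real.exp (σ * u * ∑ i, lossIncr D (eps ω') (X i ω) (xi i ω))) ∂P ≤
      ENNReal.ofReal (Real.exp (n * (σ * u * R + u * R / 4))) *
        ENNReal.ofReal (Real.exp (2 * n * σ * u * innerPi Pi (eps ω') D)) := by
    intro ω' hω'
    simp only [e1]
    have hG : Measurable fun p : Matrix (Fin d) (Fin T) ℝ × ℝ =>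
        ENNReal.ofReal (Real.exp (σ * u * lossIncr D (eps ω') p.1 p.2)) :=
      ((measurable_const.lossIncr measurable_fst measurable_snd).const_mul _).exp.ennreal_ofReal
    have hind := hpairs.comp (fun _ p =>
        ENNReal.ofReal (Real.exp (σ * u * lossIncr D (eps ω') p.1 p.2))) fun _ => hG
    have e2 := lintegral_prod_eq_prod_lintegral_of_indepFun Finset.univ _ hind
      fun i => hG.comp ((hX i).prodMk (hxi i))
    simp only [Function.comp_def] at e2
    rw [e2]
    calc _ ≤ ∏ _i : Fin n, ENNReal.ofReal (Real.exp
            (σ * u * (2 * innerPi Pi (eps ω') D + R) + u * R / 4)) :=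
          Finset.prod_le_prod' fun i _ => lintegral_exp_lossIncr_le (hX i) (hXlaw i) (hXunit i)
            (hxi i) (hmean i) (hmom i) (hpair i) hσ hu hm₀ hv hc h1 h2 h3 h5 hD hω'
      _ = _ := by
          rw [Finset.prod_const, Finset.card_univ, Fintype.card_fin,
            ← ENNReal.ofReal_pow (Real.exp_pos _).le, ← Real.exp_nat_mul,
            ← ENNReal.ofReal_mul (Real.exp_pos _).le, ← Real.exp_add]
          congr 2; ring
  have hFm : Measurable (Function.uncurry
      fun (q : Fin n → Matrix (Fin d) (Fin T) ℝ × ℝ) (e : Matrix (Fin d) (Fin T) ℝ) =>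
        ENNReal.ofReal (Real.exp (σ * u * ∑ i, lossIncr D e (q i).1 (q i).2))) := by
    refine Measurable.ennreal_ofReal (Measurable.exp (Measurable.const_mul ?_ _))
    refine Finset.measurable_fun_sum _ fun i _ => ?_
    have hq : Measurable fun p : (Fin n → Matrix (Fin d) (Fin T) ℝ × ℝ) ×
        Matrix (Fin d) (Fin T) ℝ => p.1 i := (measurable_pi_apply i).comp measurable_fst
    exact measurable_snd.lossIncr (measurable_fst.comp hq) (measurable_snd.comp hq)
  rw [lintegral_comp_of_indepFun (F := fun (q : Fin n → Matrix (Fin d) (Fin T) ℝ × ℝ) e =>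
    ENNReal.ofReal (Real.exp (σ * u * ∑ i, lossIncr D e (q i).1 (q i).2))) hpm heps hpairs_eps hFm]
  calc _ ≤ ∫⁻ ω', ENNReal.ofReal (Real.exp (n * (σ * u * R + u * R / 4))) *
        ENNReal.ofReal (Real.exp (2 * n * σ * u * innerPi Pi (eps ω') D)) ∂P := by
        refine lintegral_mono_ae ?_
        filter_upwards [hepsb] with ω' hω' using hcond ω' hω'
    _ = ENNReal.ofReal (Real.exp (n * (σ * u * R + u * R / 4))) *
        ∫⁻ ω', ENNReal.ofReal (Real.exp (2 * n * σ * u * innerPi Pi (eps ω') D)) ∂P :=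
        lintegral_const_mul' _ _ ENNReal.ofReal_ne_top
    _ ≤ ENNReal.ofReal (Real.exp (n * (σ * u * R + u * R / 4))) *
        ENNReal.ofReal (Real.exp (4 * (2 * n * σ * u) ^ 2 *
          (me ^ 2 * PhiSum P' Z n ^ 2 * cP) * R / n)) := by
        gcongr
        exact lintegral_exp_innerPi_le hPi hPib hcP heps hepsb heps0 hrows hZ hlaw hn hd hT hnT
          hme _
    _ ≤ _ := by
        rw [← ENNReal.ofReal_mul (Real.exp_pos _).le, ← Real.exp_add]
        refine ENNReal.ofReal_le_ofReal (Real.exp_le_exp.mpr ?_)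
        have hσ2 : σ ^ 2 = 1 := by rw [← sq_abs, hσ]; norm_num
        have e3 : 4 * (2 * n * σ * u) ^ 2 * (me ^ 2 * PhiSum P' Z n ^ 2 * cP) * R / n =
            16 * (n * u * R) * (u * (me ^ 2 * PhiSum P' Z n ^ 2 * cP)) := by
          rw [mul_pow, mul_pow, mul_pow, hσ2]; field_simp; ring
        rw [e3]
        have := mul_le_mul_of_nonneg_left h6 (by positivity : 0 ≤ 16 * (n * u * R))
        linarith
end

/-! ### Nets, union bound and comparison of risks -/

section
variable {d τ T : ℕ} {Lam : Matrix (Fin τ) (Fin T) ℂ}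

lemma trendC_apply (U : Matrix (Fin d) (Fin τ) ℝ) (j : Fin d) (t : Fin T) :
    trendC Lam U j t = ∑ l, (U j l : ℂ) * Lam l t := by
  simp [trendC, Matrix.mul_apply]

lemma trend_sub (U V : Matrix (Fin d) (Fin τ) ℝ) :
    trend Lam (U - V) = trend Lam U - trend Lam V := by
  ext j t
  simp [trend, trendC_apply, sub_mul]

lemma abs_trend_le_norm (U : Matrix (Fin d) (Fin τ) ℝ) (j : Fin d) (t : Fin T) :
    |trend Lam U j t| ≤ ‖trendC Lam U j t‖ :=
  Complex.abs_re_le_norm _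

lemma abs_trend_le {m m₀ : ℝ} (hLam : IsTrendBound d Lam m) {U : Matrix (Fin d) (Fin τ) ℝ}
    (hm₀ : 0 ≤ m₀) (hU : ∀ j l, |U j l| ≤ m₀ / m) (j : Fin d) (t : Fin T) :
    |trend Lam U j t| ≤ m₀ := by
  have hm : 0 < m := zero_lt_one.trans_le hLam.1
  have h1 : supAbs U ≤ m₀ / m := Real.iSup_le (fun p => hU p.1 p.2) (by positivity)
  calc |trend Lam U j t| ≤ m * supAbs U := (abs_trend_le_norm U j t).trans (hLam.2 U j t)
    _ ≤ m * (m₀ / m) := by gcongr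
    _ = m₀ := by field_simp

lemma mLam_nonneg : 0 ≤ mLam Lam := Real.iSup_nonneg fun _ => norm_nonneg _

lemma norm_le_mLam (l : Fin τ) (t : Fin T) : ‖Lam l t‖ ≤ mLam Lam :=
  le_ciSup (f := fun p : Fin τ × Fin T => ‖Lam p.1 p.2‖) (Set.finite_range _).bddAbove (l, t)

lemma abs_trend_le_mLam_mul (U : Matrix (Fin d) (Fin τ) ℝ) (j : Fin d) (t : Fin T) :
    |trend Lam U j t| ≤ mLam Lam * (Real.sqrt τ * frobNorm U) := by
  refine (abs_trend_le_norm U j t).trans ?_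
  rw [trendC_apply]
  have h1 : ∑ l, |U j l| ≤ Real.sqrt τ * frobNorm U := by
    rw [frobNorm, ← Real.sqrt_mul (Nat.cast_nonneg _)]
    refine Real.le_sqrt_of_sq_le ?_
    have h2 := sq_sum_le_card_mul_sum_sq (s := Finset.univ) (f := fun l => |U j l|)
    simp only [sq_abs, Finset.card_univ, Fintype.card_fin] at h2
    refine h2.trans (mul_le_mul_of_nonneg_left ?_ (Nat.cast_nonneg _))
    rw [frobInner_eq_sum]
    simp only [← sq]
    exact Finset.single_le_sum (f := fun j => ∑ l, U j l ^ 2)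
      (fun j _ => Finset.sum_nonneg fun l _ => sq_nonneg _) (Finset.mem_univ j)
  calc ‖∑ l, (U j l : ℂ) * Lam l t‖ ≤ ∑ l, |U j l| * mLam Lam := by
        refine (norm_sum_le _ _).trans (Finset.sum_le_sum fun l _ => ?_)
        rw [norm_mul, Complex.norm_real, Real.norm_eq_abs]
        exact mul_le_mul_of_nonneg_left (norm_le_mLam l t) (abs_nonneg _)
    _ = mLam Lam * ∑ l, |U j l| := by rw [← Finset.sum_mul, mul_comm]
    _ ≤ _ := mul_le_mul_of_nonneg_left h1 mLam_nonneg

lemma abs_le_of_mem_boundedProducts {k : ℕ} (hk : 1 ≤ k) {m₀ m : ℝ} (hm₀ : 0 ≤ m₀) (hm : 0 < m)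
    {A : Matrix (Fin d) (Fin τ) ℝ} (hA : A ∈ boundedProducts d k τ m₀ m) (j : Fin d) (l : Fin τ) :
    |A j l| ≤ m₀ / m := by
  obtain ⟨U, V, hU, hV, rfl⟩ := hA
  have hk0 : (0 : ℝ) < k := by exact_mod_cast hk
  rw [Matrix.mul_apply]
  calc |∑ i, U j i * V i l| ≤ ∑ _i : Fin k, m₀ / (k * m) := by
        refine (Finset.abs_sum_le_sum_abs _ _).trans (Finset.sum_le_sum fun i _ => ?_)
        rw [abs_mul]
        refine (mul_le_mul (hU j i) (hV i l) (abs_nonneg _) (Real.sqrt_nonneg _)).trans (le_of_eq ?_)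
        exact Real.mul_self_sqrt (by positivity)
    _ = m₀ / m := by
        rw [Finset.sum_const, Finset.card_univ, Fintype.card_fin, nsmul_eq_mul]
        field_simp

lemma frobNorm_le_of_abs_le {U : Matrix (Fin d) (Fin τ) ℝ} {η : ℝ} (hη : 0 ≤ η)
    (h : ∀ j l, |U j l| ≤ η) : frobNorm U ≤ Real.sqrt (d * τ) * η := by
  have : frobInner U U ≤ d * τ * η ^ 2 := by
    rw [frobInner_eq_sum]
    calc ∑ j, ∑ l, U j l * U j l ≤ ∑ _j : Fin d, ∑ _l : Fin τ, η ^ 2 := by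
          refine Finset.sum_le_sum fun j _ => Finset.sum_le_sum fun l _ => ?_
          rw [← sq, ← sq_abs]
          exact pow_le_pow_left₀ (abs_nonneg _) (h j l) 2
      _ = _ := by simp; ring
  rw [frobNorm]
  refine (Real.sqrt_le_sqrt this).trans (le_of_eq ?_)
  rw [Real.sqrt_mul (by positivity), Real.sqrt_sq hη]

/-- An entrywise bounded set has finite nets of any resolution, made of points of the set. -/
lemma exists_isFrobNet {S : Set (Matrix (Fin d) (Fin τ) ℝ)} {B : ℝ}
    (hS : ∀ U ∈ S, ∀ j l, |U j l| ≤ B) {r : ℝ} (hr : 0 < r) :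
    ∃ N : Finset (Matrix (Fin d) (Fin τ) ℝ), IsFrobNet S r N := by
  set η : ℝ := r / (Real.sqrt (d * τ) + 1) with hη
  have hη0 : 0 < η := by positivity
  have htb : TotallyBounded (Matrix.of ⁻¹' S : Set (Fin d → Fin τ → ℝ)) := by
    refine (isCompact_closedBall (0 : Fin d → Fin τ → ℝ) (max B 0)).totallyBounded.subset ?_
    intro U hU
    rw [mem_closedBall_zero_iff, pi_norm_le_iff_of_nonneg (le_max_right _ _)]
    intro j
    rw [pi_norm_le_iff_of_nonneg (le_max_right _ _)]
    exact fun l => (hS _ hU j l).trans (le_max_left _ _)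
  obtain ⟨N, hNS, hNf, hN⟩ := htb.exists_subset (Metric.dist_mem_uniformity hη0)
  refine ⟨hNf.toFinset.map Matrix.of.toEmbedding, ?_, fun U hU => ?_⟩
  · intro V hV
    simp only [Finset.coe_map, Set.Finite.coe_toFinset] at hV
    obtain ⟨V, hV, rfl⟩ := hV
    exact hNS hV
  obtain ⟨V, hV, hUV⟩ := Set.mem_iUnion₂.mp (hN (show Matrix.of.symm U ∈ _ from hU))
  refine ⟨Matrix.of V, Finset.mem_map_of_mem _ (hNf.mem_toFinset.mpr hV), ?_⟩
  have hdist : dist (Matrix.of.symm U) V < η := hUV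
  refine (frobNorm_le_of_abs_le hη0.le fun j l => ?_).trans ?_
  · exact ((dist_le_pi_dist (Matrix.of.symm U j) (V j) l).trans
      (dist_le_pi_dist (Matrix.of.symm U) V j)).trans hdist.le
  · rw [hη, mul_div_assoc', div_le_iff₀ (by positivity)]
    nlinarith [Real.sqrt_nonneg ((d : ℝ) * τ)]
end

/-- A probability bound that holds for each comparison point also holds for the infimum, attained
or not: along a minimizing sequence, the exceptional events are nested. -/
lemma measure_not_le_iInf_add_le {Ω ι : Type*} [MeasurableSpace Ω] {P : Measure Ω} [Nonempty ι]
    {R : ι → ℝ} {err G : Ω → ℝ} {a : ENNReal} {c : ℝ} (hc : 0 < c)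
    (h : ∀ i, P {ω | ¬ err ω ≤ c * R i + G ω} ≤ a) :
    P {ω | ¬ err ω ≤ c * (⨅ i, R i) + G ω} ≤ a := by
  have hseq : ∀ m : ℕ, ∃ i, R i < (⨅ i, R i) + 1 / (m + 1) := fun m =>
    exists_lt_of_ciInf_lt (lt_add_of_pos_right _ (by positivity))
  choose I hI using hseq
  set E : ℕ → Set Ω := fun m => {ω | ¬ err ω ≤ c * R (I m) + G ω} with hE
  have hmono : ∀ m m', R (I m) ≤ R (I m') → E m' ⊆ E m := by
    intro m m' hmm ω hω hle
    refine hω (hle.trans ?_)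
    gcongr
  have hdir : Directed (· ⊆ ·) E := by
    intro m m'
    rcases le_total (R (I m)) (R (I m')) with h' | h'
    · exact ⟨m, subset_rfl, hmono _ _ h'⟩
    · exact ⟨m', hmono _ _ h', subset_rfl⟩
  calc P {ω | ¬ err ω ≤ c * (⨅ i, R i) + G ω} ≤ P (⋃ m, E m) := by
        refine measure_mono fun ω hω => ?_
        have hω' : c * (⨅ i, R i) + G ω < err ω := not_le.mp hω
        obtain ⟨m, hm⟩ := exists_nat_one_div_lt
          (div_pos (sub_pos.mpr hω') hc : 0 < (err ω - (c * (⨅ i, R i) + G ω)) / c)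
        refine Set.mem_iUnion.mpr ⟨m, not_le.mpr ?_⟩
        rw [lt_div_iff₀ hc] at hm
        have := mul_lt_mul_of_pos_left (hI m) hc
        linarith
    _ = ⨆ m, P (E m) := hdir.measure_iUnion
    _ ≤ a := iSup_le fun m => h _

/-- The union bound: the lower deviations are controlled on all of `N`, each with probability `α /
(2 |N|)`, and the upper deviation only at the comparison point `A`. -/
lemma measure_not_forall_net_le {Ω β : Type*} [MeasurableSpace Ω] {P : Measure Ω} {f : β → Ω → ℝ}
    {R : β → ℝ} {w u α : ℝ} {N : Finset β} (hN : N.Nonempty) {A : β} (hα : 0 < α)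
    (h : ∀ U, U ∈ N ∨ U = A → ∀ σ : ℝ, |σ| = 1 → ∀ l : ℝ,
      P {ω | w * u * (σ * R U + R U / 2) + l < σ * u * f U ω} ≤ ENNReal.ofReal (Real.exp (-l))) :
    P {ω | ¬ ((∀ V ∈ N, w * u * (R V / 2) ≤ u * f V ω + Real.log (2 / α * N.card)) ∧
      u * f A ω ≤ w * u * (3 / 2 * R A) + Real.log (2 / α * N.card))} ≤ ENNReal.ofReal α := by
  set l := Real.log (2 / α * N.card) with hl
  have hcard : (1 : ℝ) ≤ N.card := by exact_mod_cast hN.card_pos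
  have hexp : Real.exp (-l) = α / (2 * N.card) := by
    rw [hl, ← Real.log_inv, Real.exp_log (by positivity)]
    field_simp
  calc _ ≤ P ((⋃ V ∈ N, {ω | w * u * (-1 * R V + R V / 2) + l < -1 * u * f V ω}) ∪
        {ω | w * u * (1 * R A + R A / 2) + l < 1 * u * f A ω}) := by
        refine measure_mono fun ω hω => ?_
        rw [Set.mem_ofPred_eq, not_and_or] at hω
        rcases hω with hω | hω
        · push Not at hω
          obtain ⟨V, hV, hlt⟩ := hω
          refine Or.inl (Set.mem_iUnion₂.mpr ⟨V, hV, ?_⟩)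
          rw [Set.mem_ofPred_eq]
          linarith
        · refine Or.inr ?_
          rw [not_le] at hω
          rw [Set.mem_ofPred_eq]
          linarith
    _ ≤ ∑ _V ∈ N, ENNReal.ofReal (Real.exp (-l)) + ENNReal.ofReal (Real.exp (-l)) := by
        refine (measure_union_le _ _).trans (add_le_add ?_ (h A (Or.inr rfl) 1 (by simp) l))
        refine (measure_biUnion_finset_le _ _).trans (Finset.sum_le_sum fun V hV => ?_)
        exact h V (Or.inl hV) (-1) (by simp) l
    _ = ENNReal.ofReal (N.card * (α / (2 * N.card)) + α / (2 * N.card)) := by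
        rw [Finset.sum_const, hexp, nsmul_eq_mul, ENNReal.ofReal_add (by positivity) (by positivity),
          ENNReal.ofReal_mul (by positivity), ENNReal.ofReal_natCast]
    _ ≤ ENNReal.ofReal α := by
        refine ENNReal.ofReal_le_ofReal ?_
        have h1 : N.card * (α / (2 * N.card)) = α / 2 := by field_simp
        have h2 : α / (2 * N.card) ≤ α / 2 := by
          gcongr; linarith
        linarith

section
variable {d T n : ℕ}

/-- The empirical risk at `A`, compared with that at the true parameter `Θ`. -/
lemma empRisk_obs_eq {y z : Fin n → ℝ} {x : Fin n → Matrix (Fin d) (Fin T) ℝ}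
    {Θ e A : Matrix (Fin d) (Fin T) ℝ}
    (hy : ∀ i, y i = ((x i).transpose * (Θ + e)).trace + z i) :
    empRisk y x A = empRisk y x Θ + (1 / n) * ∑ i, lossIncr (Θ - A) e (x i) (z i) := by
  rw [empRisk, empRisk, ← mul_add, ← Finset.sum_add_distrib]
  congr 1
  refine Finset.sum_congr rfl fun i _ => ?_
  have : y i = frobInner (x i) Θ + frobInner (x i) e + z i := by
    rw [hy, ← frobInner_add_right]; rfl
  rw [this, lossIncr, frobInner_sub_right]
  ring

lemma lossIncr_le_add {D D' e x : Matrix (Fin d) (Fin T) ℝ} {z δ m₀ me : ℝ}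
    (hx : x ∈ matrixUnits d T) (he : ∀ j t, |e j t| ≤ me) (hD : ∀ j t, |D j t| ≤ 2 * m₀)
    (hD' : ∀ j t, |D' j t| ≤ 2 * m₀) (hDD : ∀ j t, |D j t - D' j t| ≤ δ) :
    lossIncr D e x z ≤ lossIncr D' e x z + δ * (2 * |z| + 2 * me + 4 * m₀) := by
  obtain ⟨j, t, rfl⟩ := hx
  simp only [lossIncr, frobInner_single]
  have h1 : |2 * (e j t + z) + (D j t + D' j t)| ≤ 2 * |z| + 2 * me + 4 * m₀ := by
    have a1 := abs_le.mp (he j t)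
    have a2 := abs_le.mp (hD j t)
    have a3 := abs_le.mp (hD' j t)
    have a4 := abs_le.mp (le_refl |z|)
    rw [abs_le]; constructor <;> linarith
  have h2 := (le_abs_self _).trans_eq (abs_mul (D j t - D' j t) (2 * (e j t + z) + (D j t + D' j t)))
  have h3 := h2.trans (mul_le_mul (hDD j t) h1 (abs_nonneg _) ((abs_nonneg _).trans (hDD j t)))
  linarith

lemma normSqPi_sub_comm {Pi : Measure (Matrix (Fin d) (Fin T) ℝ)} (A B : Matrix (Fin d) (Fin T) ℝ) :
    normSqPi Pi (A - B) = normSqPi Pi (B - A) := by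
  simp only [normSqPi, frobInner_sub_right]
  congr 1; ext X; ring

lemma normSqPi_le_add {Pi : Measure (Matrix (Fin d) (Fin T) ℝ)} [IsProbabilityMeasure Pi]
    (hPi : ∀ᵐ x ∂Pi, x ∈ matrixUnits d T) {D D' : Matrix (Fin d) (Fin T) ℝ} {δ m₀ : ℝ}
    (hD : ∀ j t, |D j t| ≤ 2 * m₀) (hD' : ∀ j t, |D' j t| ≤ 2 * m₀)
    (hDD : ∀ j t, |D j t - D' j t| ≤ δ) :
    normSqPi Pi D ≤ normSqPi Pi D' + 4 * m₀ * δ := by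
  have e1 : normSqPi Pi D' + 4 * m₀ * δ =
      ∫ x, (frobInner x D' * frobInner x D' + 4 * m₀ * δ) ∂Pi := by
    rw [integral_add (integrable_of_units hPi _) (integrable_const _)]
    simp [normSqPi]
  rw [e1]
  refine integral_mono_ae (integrable_of_units hPi _) (integrable_of_units hPi _) ?_
  filter_upwards [hPi] with x hx
  obtain ⟨j, t, rfl⟩ := hx
  simp only [frobInner_single]
  have h1 : |D j t + D' j t| ≤ 4 * m₀ := (abs_add_le _ _).trans (by linarith [hD j t, hD' j t])
  have h2 := (le_abs_self _).trans_eq (abs_mul (D j t - D' j t) (D j t + D' j t))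
  have h3 := h2.trans (mul_le_mul (hDD j t) h1 (abs_nonneg _) ((abs_nonneg _).trans (hDD j t)))
  linarith

end

section
variable {m₀ v me Φ c cP : ℝ}

lemma constExp_bounds (hm₀ : 0 < m₀) :
    0 < constExp m₀ v me Φ cP ∧ 16 * m₀ ^ 2 ≤ constExp m₀ v me Φ cP ∧
    16 * v ≤ constExp m₀ v me Φ cP ∧ 16 * me ^ 2 ≤ constExp m₀ v me Φ cP ∧
    8 * (me ^ 2 * Φ ^ 2 * cP) ≤ constExp m₀ v me Φ cP := by
  have h1 := (le_max_left (4 * m₀ ^ 2) (4 * v)).trans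
    (le_max_left _ (max (4 * me ^ 2) (2 * me ^ 2 * Φ ^ 2 * cP)))
  have h2 := (le_max_right (4 * m₀ ^ 2) (4 * v)).trans
    (le_max_left _ (max (4 * me ^ 2) (2 * me ^ 2 * Φ ^ 2 * cP)))
  have h3 := (le_max_left (4 * me ^ 2) (2 * me ^ 2 * Φ ^ 2 * cP)).trans
    (le_max_right (max (4 * m₀ ^ 2) (4 * v)) _)
  have h4 := (le_max_right (4 * me ^ 2) (2 * me ^ 2 * Φ ^ 2 * cP)).trans
    (le_max_right (max (4 * m₀ ^ 2) (4 * v)) _)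
  have h0 : 0 < m₀ ^ 2 := by positivity
  unfold constExp
  refine ⟨by linarith, by linarith, by linarith, by linarith, by linarith⟩

/-- The rate `u = min c₀⁻¹ λ* / 8` of the exponential inequality, for which `c₁ = 4 / u`. -/
lemma exists_rate (hm₀ : 0 < m₀) :
    ∃ u : ℝ, 0 < u ∧ 4 / u = constOne m₀ v c me Φ cP ∧ u * m₀ ^ 2 ≤ 1 / 128 ∧ u * v ≤ 1 / 128 ∧
      u * me ^ 2 ≤ 1 / 128 ∧ u * (m₀ * c) ≤ 1 / 128 ∧ u * (me ^ 2 * Φ ^ 2 * cP) ≤ 1 / 64 := by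
  obtain ⟨h0, h1, h2, h3, h4⟩ := constExp_bounds (v := v) (me := me) (Φ := Φ) (cP := cP) hm₀
  set c₀ := constExp m₀ v me Φ cP with hc₀
  have hmax : 0 < max m₀ (max me c) := hm₀.trans_le (le_max_left _ _)
  have hl : 0 < lambdaStar m₀ me c := by unfold lambdaStar; positivity
  set μ := min c₀⁻¹ (lambdaStar m₀ me c) with hμ
  have hμ0 : 0 < μ := lt_min (inv_pos.mpr h0) hl
  have key : ∀ x K : ℝ, 0 < K → K * x ≤ c₀ → μ / 8 * x ≤ 1 / (8 * K) := by
    intro x K hK hx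
    rcases le_or_gt x 0 with hx0 | hx0
    · exact (mul_nonpos_of_nonneg_of_nonpos (by positivity) hx0).trans (by positivity)
    · have e1 : μ ≤ (K * x)⁻¹ := (min_le_left _ _).trans (inv_anti₀ (by positivity) hx)
      calc μ / 8 * x ≤ (K * x)⁻¹ / 8 * x := by gcongr
        _ = 1 / (8 * K) := by field_simp
  refine ⟨μ / 8, by positivity, ?_, ?_, ?_, ?_, ?_, ?_⟩
  · unfold constOne; rw [← hc₀, ← hμ]; field_simp; norm_num
  · exact (key _ 16 (by norm_num) h1).trans (by norm_num)
  · exact (key _ 16 (by norm_num) h2).trans (by norm_num)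
  · exact (key _ 16 (by norm_num) h3).trans (by norm_num)
  · have e1 : μ ≤ (16 * m₀ * max m₀ (max me c))⁻¹ := min_le_right _ _
    have e2 : m₀ * c ≤ m₀ * max m₀ (max me c) :=
      mul_le_mul_of_nonneg_left ((le_max_right _ _).trans (le_max_right _ _)) hm₀.le
    calc μ / 8 * (m₀ * c) ≤ μ / 8 * (m₀ * max m₀ (max me c)) := by gcongr
      _ ≤ (16 * m₀ * max m₀ (max me c))⁻¹ / 8 * (m₀ * max m₀ (max me c)) := by gcongr
      _ = 1 / 128 := by field_simp; norm_num
  · exact (key _ 8 (by norm_num) h4).trans (by norm_num)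
end

/-! ### Oracle inequality -/

lemma measure_not_le_mono {Ω : Type*} [MeasurableSpace Ω] {P : Measure Ω} {f : Ω → ℝ} {b c : ℝ}
    (h : b ≤ c) : P {ω | ¬ f ω ≤ c} ≤ P {ω | ¬ f ω ≤ b} :=
  measure_mono fun _ hω (hle : _ ≤ b) => hω (hle.trans h)

/-- The oracle inequality on a net that is `δ`-fine for the entries of `U Λ`, with the random term
`n⁻¹ ∑ |ξ_i|` not yet bounded. On the event of the union bound, the error of the estimator is
carried to a close point `V` of the net, from its error to its empirical risk, back to the
estimator, then to `A` by minimality, and to the error of `A`. -/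
lemma measure_not_err_le {Ω : Type*} [MeasurableSpace Ω] {P : Measure Ω} {d T τ n : ℕ}
    (hn : 1 ≤ n) {Lam : Matrix (Fin τ) (Fin T) ℂ} {T₀ : Matrix (Fin d) (Fin τ) ℝ}
    {S : Set (Matrix (Fin d) (Fin τ) ℝ)} {X : Fin n → Ω → Matrix (Fin d) (Fin T) ℝ}
    {xi : Fin n → Ω → ℝ} {eps : Ω → Matrix (Fin d) (Fin T) ℝ}
    {That : Ω → Matrix (Fin d) (Fin τ) ℝ} {Pi : Measure (Matrix (Fin d) (Fin T) ℝ)}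
    [IsProbabilityMeasure Pi] (hPi : ∀ᵐ x ∂Pi, x ∈ matrixUnits d T)
    (hXunit : ∀ i, ∀ᵐ ω ∂P, X i ω ∈ matrixUnits d T) {m₀ me u α δ : ℝ}
    (hepsb : ∀ᵐ ω ∂P, ∀ j t, |eps ω j t| ≤ me)
    (hThat : ∀ᵐ ω ∂P, IsLeastSquares Lam S
      (fun i => obs (trend Lam T₀) eps X xi i ω) (fun i => X i ω) (That ω))
    (hD : ∀ U ∈ S, ∀ j t, |(trend Lam T₀ - trend Lam U) j t| ≤ 2 * m₀)
    (hu : 0 < u) (hα : 0 < α)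
    (hconc : ∀ U ∈ S, ∀ σ : ℝ, |σ| = 1 → ∀ l : ℝ,
      P {ω | n * u * (σ * normSqPi Pi (trend Lam T₀ - trend Lam U) +
          normSqPi Pi (trend Lam T₀ - trend Lam U) / 2) + l <
        σ * u * ∑ i, lossIncr (trend Lam T₀ - trend Lam U) (eps ω) (X i ω) (xi i ω)} ≤
        ENNReal.ofReal (Real.exp (-l)))
    {N : Finset (Matrix (Fin d) (Fin τ) ℝ)} (hNS : (N : Set (Matrix (Fin d) (Fin τ) ℝ)) ⊆ S)
    (hNnet : ∀ U ∈ S, ∃ V ∈ N, ∀ j t, |trend Lam (U - V) j t| ≤ δ) (hSne : S.Nonempty) :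
    P {ω | ¬ normSqPi Pi (trend Lam (That ω) - trend Lam T₀) ≤
      3 * (⨅ U : S, normSqPi Pi (trend Lam ((U : Matrix (Fin d) (Fin τ) ℝ) - T₀))) +
      (4 / u / n * Real.log (2 / α * N.card) +
        δ * (4 * ((1 / n) * ∑ i, |xi i ω|) + 4 * me + 12 * m₀))} ≤ ENNReal.ofReal α := by
  have hn0 : (0 : ℝ) < n := by exact_mod_cast hn
  have : Nonempty S := hSne.to_subtype
  have hNne : N.Nonempty := by
    obtain ⟨U, hU⟩ := hSne
    obtain ⟨V, hV, -⟩ := hNnet U hU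
    exact ⟨V, hV⟩
  refine measure_not_le_iInf_add_le (by norm_num) fun A => ?_
  set R : Matrix (Fin d) (Fin τ) ℝ → ℝ := fun U => normSqPi Pi (trend Lam T₀ - trend Lam U) with hR
  set f : Matrix (Fin d) (Fin τ) ℝ → Ω → ℝ := fun U ω =>
    ∑ i, lossIncr (trend Lam T₀ - trend Lam U) (eps ω) (X i ω) (xi i ω) with hf
  set l := Real.log (2 / α * N.card) with hl
  have hU := measure_not_forall_net_le (P := P) (f := f) (R := R) (w := n) (u := u) (α := α) hNne
    (A := A.1) hα (by
      rintro U (hU | rfl) σ hσ l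
      · exact hconc U (hNS hU) σ hσ l
      · exact hconc A.1 A.2 σ hσ l)
  refine le_trans (measure_mono_ae ?_) hU
  filter_upwards [ae_all_iff.mpr hXunit, hepsb, hThat] with ω hXω hεω hLS
  intro hω hgood
  refine hω ?_
  obtain ⟨hlow, hup⟩ := hgood
  obtain ⟨V, hV, hVδ⟩ := hNnet (That ω) hLS.1
  rw [normSqPi_sub_comm, trend_sub, normSqPi_sub_comm (trend Lam A.1)]
  change R (That ω) ≤ 3 * R A + _
  have hVδ' : ∀ j t, |(trend Lam T₀ - trend Lam (That ω)) j t -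
      (trend Lam T₀ - trend Lam V) j t| ≤ δ := by
    intro j t
    have e : (trend Lam T₀ - trend Lam (That ω)) j t - (trend Lam T₀ - trend Lam V) j t =
        -(trend Lam (That ω - V) j t) := by
      rw [trend_sub]; simp only [Matrix.sub_apply]; ring
    rw [e, abs_neg]; exact hVδ j t
  have s1 : R (That ω) ≤ R V + 4 * m₀ * δ :=
    normSqPi_le_add hPi (hD _ hLS.1) (hD _ (hNS hV)) hVδ'
  have s2 : f V ω ≤ f (That ω) ω + δ * (2 * (∑ i, |xi i ω|) + n * (2 * me + 4 * m₀)) := by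
    have e : δ * (2 * (∑ i, |xi i ω|) + n * (2 * me + 4 * m₀)) =
        ∑ i, δ * (2 * |xi i ω| + 2 * me + 4 * m₀) := by
      rw [← Finset.mul_sum, Finset.sum_add_distrib, Finset.sum_add_distrib, ← Finset.mul_sum]
      simp only [Finset.sum_const, Finset.card_univ, Fintype.card_fin, nsmul_eq_mul]
      ring
    rw [e, hf, ← Finset.sum_add_distrib]
    refine Finset.sum_le_sum fun i _ => ?_
    refine lossIncr_le_add (hXω i) hεω (hD _ (hNS hV)) (hD _ hLS.1) fun j t => ?_
    rw [abs_sub_comm]; exact hVδ' j t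
  have s3 : f (That ω) ω ≤ f A ω := by
    have h := hLS.2 A.1 A.2
    have e : ∀ U, empRisk (fun i => obs (trend Lam T₀) eps X xi i ω) (fun i => X i ω)
        (trend Lam U) = empRisk (fun i => obs (trend Lam T₀) eps X xi i ω) (fun i => X i ω)
          (trend Lam T₀) + (1 / n) * f U ω :=
      fun U => empRisk_obs_eq (z := fun i => xi i ω) fun i => rfl
    rw [e (That ω), e A.1] at h
    have h' := le_of_add_le_add_left h
    exact le_of_mul_le_mul_left h' (by positivity)
  have s4 := hlow V hV
  have hnu : 0 < n * u := by positivity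
  -- everything multiplied by `n u / 2`
  have s5 : n * u / 2 * R (That ω) ≤ n * u / 2 * (3 * R A + (4 / u / n * l +
      δ * (4 * ((1 / n) * ∑ i, |xi i ω|) + 4 * me + 12 * m₀))) := by
    have e : n * u / 2 * (3 * R A + (4 / u / n * l +
        δ * (4 * ((1 / n) * ∑ i, |xi i ω|) + 4 * me + 12 * m₀))) =
        n * u * (3 / 2 * R A) + 2 * l + u * (δ * (2 * (∑ i, |xi i ω|) + n * (2 * me + 4 * m₀))) +
          n * u / 2 * (4 * m₀ * δ) := by
      field_simp; ring
    rw [e]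
    have t1 := mul_le_mul_of_nonneg_left s1 (by positivity : 0 ≤ n * u / 2)
    have t2 := mul_le_mul_of_nonneg_left (s2.trans (add_le_add_left s3 _)) hu.le
    rw [mul_add] at t1 t2
    linarith
  exact le_of_mul_le_mul_left s5 (by positivity)

end MatrixCompletion

theorem theorem4
    {Ω Ω' : Type*} [MeasurableSpace Ω] [MeasurableSpace Ω']
    (P : Measure Ω) [IsProbabilityMeasure P] (P' : Measure Ω') [IsProbabilityMeasure P']
    -- dimensions
    (d T τ k n : ℕ) (hd : 1 ≤ d) (hT : 1 ≤ T) (hτ : 1 ≤ τ) (hk : 1 ≤ k)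
    (hn : 1 ≤ n) (hnT : n ≤ d * T)
    -- constants
    (m₀ mLamTau m_eps v_xi c_xi c_Pi : ℝ) (hm₀ : 0 < m₀) (hm_eps : 0 < m_eps)
    (hv_xi : 0 < v_xi) (hc_xi : 0 < c_xi) (hc_Pi : 0 < c_Pi)
    -- the structure matrix `Λ`, the true parameter `T⁰` and the parameter set `S`
    (Lam : Matrix (Fin τ) (Fin T) ℂ) (hLam : MatrixCompletion.IsTrendBound d Lam mLamTau)
    (T₀ : Matrix (Fin d) (Fin τ) ℝ) (hT₀ : ∀ j l, |T₀ j l| ≤ m₀ / mLamTau)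
    (S : Set (Matrix (Fin d) (Fin τ) ℝ))
    (hS : S ⊆ MatrixCompletion.boundedProducts d k τ m₀ mLamTau)
    (hreal : ∀ U ∈ insert T₀ S, ∀ j t, (MatrixCompletion.trendC Lam U j t).im = 0)
    -- the sampling matrices `X_i`, identically distributed with law `Π` on the matrix units
    (X : Fin n → Ω → Matrix (Fin d) (Fin T) ℝ) (hX : ∀ i, Measurable (X i))
    (Pi : Measure (Matrix (Fin d) (Fin T) ℝ)) (hXlaw : ∀ i, P.map (X i) = Pi)
    (hXunit : ∀ i, ∀ᵐ ω ∂P, X i ω ∈ MatrixCompletion.matrixUnits d T)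
    (hPi : ∀ j t, Pi.real {Matrix.single j t (1 : ℝ)} ≤ c_Pi / (d * T))
    -- the observation noise `ξ_i`, identically distributed and centered
    (xi : Fin n → Ω → ℝ) (hxi : ∀ i, Measurable (xi i))
    (hxi_id : ∀ i i', IdentDistrib (xi i) (xi i') P P)
    (hxi_mean : ∀ i, ∫ ω, xi i ω ∂P = 0)
    (hxi_mom : ∀ i, MatrixCompletion.HasBernsteinMoments P (xi i) v_xi c_xi)
    -- the noise matrix `ε`: bounded, with independent centered rows, each distributed as a piece
    -- of the process `Z`
    (eps : Ω → Matrix (Fin d) (Fin T) ℝ) (heps : Measurable eps)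
    (heps_bdd : ∀ᵐ ω ∂P, ∀ j t, |eps ω j t| ≤ m_eps)
    (heps_mean : ∀ j t, ∫ ω, eps ω j t ∂P = 0)
    (heps_rows : iIndepFun (fun (j : Fin d) (ω : Ω) => (eps ω j : Fin T → ℝ)) P)
    (Z : ℤ → Ω' → ℝ) (hZ : ∀ t, Measurable (Z t))
    (heps_law : ∀ j, P.map (fun ω => (eps ω j : Fin T → ℝ)) =
      P'.map (fun ω' (t : Fin T) => Z ((t : ℤ) + 1) ω'))
    -- `X_1, …, X_n, ξ_1, …, ξ_n, ε` are mutually independent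
    (hpair : ∀ i, IndepFun (X i) (xi i) P)
    (hpairs : iIndepFun (fun (i : Fin n) (ω : Ω) => (X i ω, xi i ω)) P)
    (hpairs_eps : IndepFun (fun (ω : Ω) (i : Fin n) => (X i ω, xi i ω)) eps P)
    -- the least-squares estimator
    (That : Ω → Matrix (Fin d) (Fin τ) ℝ)
    (hThat : ∀ᵐ ω ∂P, MatrixCompletion.IsLeastSquares Lam S
      (fun i => MatrixCompletion.obs (MatrixCompletion.trend Lam T₀) eps X xi i ω)
      (fun i => X i ω) (That ω))
    -- the level
    (α : ℝ) (hα : α ∈ Set.Ioo (0 : ℝ) 1) :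
    let err : Ω → ℝ := fun ω => MatrixCompletion.normSqPi Pi
      (MatrixCompletion.trend Lam (That ω) - MatrixCompletion.trend Lam T₀)
    let bias : ℝ := ⨅ U : S, MatrixCompletion.normSqPi Pi
      (MatrixCompletion.trend Lam ((U : Matrix (Fin d) (Fin τ) ℝ) - T₀))
    let c₁ : ℝ := MatrixCompletion.constOne m₀ v_xi c_xi m_eps
      (MatrixCompletion.PhiSum P' Z n) c_Pi
    let c₂ : ℝ := MatrixCompletion.constTwo m₀ v_xi c_xi m_eps (MatrixCompletion.mLam Lam)
    -- the bound in terms of a finite set `N` and of the resolution `r`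
    let bound : Finset (Matrix (Fin d) (Fin τ) ℝ) → ℝ → ℝ := fun N r =>
      3 * bias + c₁ / n * Real.log (2 / α * N.card) +
        (c₂ + 8 * MatrixCompletion.mLam Lam * c_xi * Real.log (1 / α)) * r
    -- finite parameter sets
    (S.Finite →
      P {ω | ¬ err ω ≤ 3 * bias + c₁ / n * Real.log (2 / α * S.ncard)} ≤ ENNReal.ofReal α) ∧
    -- general parameter sets
    (∀ r : ℝ, 0 < r →
      (∃ N : Finset (Matrix (Fin d) (Fin τ) ℝ), MatrixCompletion.IsFrobNet S r N ∧
        P {ω | ¬ err ω ≤ bound N r} ≤ ENNReal.ofReal α) ∧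
      -- arbitrary nets at the finer resolution `r / √τ`
      (∀ N : Finset (Matrix (Fin d) (Fin τ) ℝ),
        MatrixCompletion.IsFrobNet S (r / Real.sqrt τ) N →
        P {ω | ¬ err ω ≤ bound N r} ≤ ENNReal.ofReal (2 * α))) := by
  have i0 : Fin n := ⟨0, hn⟩
  have hPiprob : IsProbabilityMeasure Pi :=
    hXlaw i0 ▸ Measure.isProbabilityMeasure_map (hX i0).aemeasurable
  have hPiunit : ∀ᵐ x ∂Pi, x ∈ MatrixCompletion.matrixUnits d T := by
    rw [← hXlaw i0]
    exact (ae_map_iff (hX i0).aemeasurable MatrixCompletion.measurableSet_matrixUnits).mpr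
      (hXunit i0)
  have hn0 : (0 : ℝ) < n := by exact_mod_cast hn
  have hmL : 0 < mLamTau := zero_lt_one.trans_le hLam.1
  have hSb : ∀ U ∈ S, ∀ j l, |U j l| ≤ m₀ / mLamTau := fun U hU =>
    MatrixCompletion.abs_le_of_mem_boundedProducts hk hm₀.le hmL (hS hU)
  have hSne : S.Nonempty := by
    obtain ⟨ω, hω⟩ := hThat.exists
    exact ⟨_, hω.1⟩
  have hD : ∀ U ∈ S, ∀ j t,
      |(MatrixCompletion.trend Lam T₀ - MatrixCompletion.trend Lam U) j t| ≤ 2 * m₀ := by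
    intro U hU j t
    have h1 := MatrixCompletion.abs_trend_le hLam hm₀.le hT₀ j t
    have h2 := MatrixCompletion.abs_trend_le hLam hm₀.le (hSb U hU) j t
    rw [Matrix.sub_apply]
    exact (abs_sub _ _).trans (by linarith)
  obtain ⟨u, hu, hu4, hu1, hu2, hu3, hu5, hu6⟩ := MatrixCompletion.exists_rate (v := v_xi)
    (me := m_eps) (Φ := MatrixCompletion.PhiSum P' Z n) (c := c_xi) (cP := c_Pi) hm₀
  have hconc : ∀ U ∈ S, ∀ σ : ℝ, |σ| = 1 → ∀ l : ℝ,
      P {ω | n * u * (σ * MatrixCompletion.normSqPi Pi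
            (MatrixCompletion.trend Lam T₀ - MatrixCompletion.trend Lam U) +
          MatrixCompletion.normSqPi Pi
            (MatrixCompletion.trend Lam T₀ - MatrixCompletion.trend Lam U) / 2) + l <
        σ * u * ∑ i, MatrixCompletion.lossIncr
          (MatrixCompletion.trend Lam T₀ - MatrixCompletion.trend Lam U)
          (eps ω) (X i ω) (xi i ω)} ≤
        ENNReal.ofReal (Real.exp (-l)) := by
    intro U hU σ hσ l
    refine MatrixCompletion.measure_add_lt_le_of_lintegral_exp_le ?_
      (MatrixCompletion.lintegral_exp_sum_lossIncr_le hX hXlaw hXunit hPi hc_Pi.le hxi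
        hxi_mean hxi_mom heps heps_bdd heps_mean heps_rows hZ heps_law hpair hpairs hpairs_eps hn hd hT hnT hσ hu.le
        hm_eps.le hm₀.le hv_xi.le hc_xi.le hu1 hu2 hu3 hu5 hu6 (hD U hU)) l
    exact (Finset.measurable_fun_sum _ fun i _ => heps.lossIncr (hX i) (hxi i)).const_mul _
  intro err bias c₁ c₂ bound
  have hmLam : 0 ≤ MatrixCompletion.mLam Lam := MatrixCompletion.mLam_nonneg
  have hc₂ : 0 ≤ c₂ := by
    simp only [c₂, MatrixCompletion.constTwo]
    positivity
  have hc₁ : 0 < c₁ := by simp only [c₁, ← hu4]; positivity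
  have hfin : S.Finite → P {ω | ¬ err ω ≤ 3 * bias + c₁ / n * Real.log (2 / α * S.ncard)} ≤
      ENNReal.ofReal α := by
    intro hSfin
    have h := MatrixCompletion.measure_not_err_le hn (δ := 0) (N := hSfin.toFinset) hPiunit
      hXunit heps_bdd hThat hD hu hα.1 hconc (by simp)
      (fun U hU => ⟨U, by simpa using hU, fun j t => by
        rw [MatrixCompletion.trend_sub, sub_self]; simp⟩) hSne
    rw [hu4, ← Set.ncard_eq_toFinset_card S hSfin] at h
    simpa only [zero_mul, add_zero] using h
  have hnet : ∀ β ∈ Set.Ioo (0 : ℝ) 1, ∀ r : ℝ, 0 < r → ∀ N : Finset (Matrix (Fin d) (Fin τ) ℝ),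
      MatrixCompletion.IsFrobNet S (r / Real.sqrt τ) N →
      P {ω | ¬ err ω ≤ 3 * bias + c₁ / n * Real.log (2 / β * N.card) +
        (c₂ + 8 * MatrixCompletion.mLam Lam * c_xi * Real.log (1 / β)) * r} ≤
        ENNReal.ofReal (2 * β) := by
    intro β hβ r hr N hN
    have hτ0 : 0 < Real.sqrt τ := Real.sqrt_pos.mpr (by exact_mod_cast hτ)
    have h1 := MatrixCompletion.measure_not_err_le hn (δ := MatrixCompletion.mLam Lam * r)
      (N := N) hPiunit hXunit heps_bdd hThat hD hu hβ.1 hconc hN.1 (fun U hU => by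
        obtain ⟨V, hV, hUV⟩ := hN.2 U hU
        refine ⟨V, hV, fun j t => (MatrixCompletion.abs_trend_le_mLam_mul _ j t).trans ?_⟩
        refine mul_le_mul_of_nonneg_left ?_ hmLam
        rw [le_div_iff₀ hτ0] at hUV
        linarith) hSne
    rw [hu4] at h1
    have hind : iIndepFun xi P := hpairs.comp (fun _ p => p.2) fun _ => measurable_snd
    have h2 := MatrixCompletion.measure_avg_abs_gt_le hn hxi hind hv_xi.le hc_xi hxi_mom hβ.1
      hβ.2.le
    have h3 := (measure_union_le _ _).trans (add_le_add h1 h2)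
    rw [← ENNReal.ofReal_add hβ.1.le hβ.1.le, ← two_mul] at h3
    refine le_trans (measure_mono fun ω hω => ?_) h3
    by_contra hcon
    simp only [Set.mem_union, Set.mem_ofPred_eq, not_or, not_not, not_lt] at hcon
    refine hω (hcon.1.trans ?_)
    have h4 := mul_le_mul_of_nonneg_left hcon.2
      (by positivity : 0 ≤ 4 * (MatrixCompletion.mLam Lam * r))
    simp only [c₂, bias, c₁, MatrixCompletion.constTwo]
    linarith
  refine ⟨hfin, fun r hr => ⟨?_, fun N hN => hnet α hα r hr N hN⟩⟩
  have hlog0 : 0 ≤ Real.log (1 / α) :=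
    Real.log_nonneg (by rw [le_div_iff₀ hα.1]; linarith [hα.2])
  by_cases hSfin : S.Finite
  · refine ⟨hSfin.toFinset, ⟨by simp, fun U hU => ⟨U, by simpa using hU, ?_⟩⟩, ?_⟩
    · simp [MatrixCompletion.frobNorm, MatrixCompletion.frobInner, hr.le]
    · have hle : 3 * bias + c₁ / n * Real.log (2 / α * S.ncard) ≤ bound hSfin.toFinset r := by
        simp only [bound, ← Set.ncard_eq_toFinset_card S hSfin]
        exact le_add_of_nonneg_right (by positivity)
      exact (MatrixCompletion.measure_not_le_mono hle).trans (hfin hSfin)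
  -- For infinite `S` there is room to enlarge a net. A net of resolution `r / ((1 + K) √τ)` is
  -- completed to twice its size, and the bound for arbitrary nets is used at the level `α / 2`: the
  -- doubled cardinality absorbs the change of level in `log (2 |N| / α)`, and the factor `1 + K`
  -- absorbs the extra `log 2` in the last term.
  · set K : ℝ := 8 * c_xi * Real.log 2 /
      (4 * (Real.sqrt v_xi + v_xi / (2 * c_xi) + m_eps + 3 * m₀)) with hK
    have hlog2 : 0 < Real.log 2 := Real.log_pos one_lt_two
    have hK0 : 0 ≤ K := by positivity
    have hKc : 8 * MatrixCompletion.mLam Lam * c_xi * Real.log 2 = K * c₂ := by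
      simp only [hK, c₂, MatrixCompletion.constTwo]
      field_simp
    have hτ1 : 1 ≤ Real.sqrt τ := Real.one_le_sqrt.mpr (by exact_mod_cast hτ)
    set r' : ℝ := r / (1 + K) with hr'
    have hr'0 : 0 < r' := by positivity
    have hr'r : r' ≤ r := div_le_self hr.le (by linarith)
    obtain ⟨N', hN'⟩ := MatrixCompletion.exists_isFrobNet hSb
      (show 0 < r' / Real.sqrt τ by positivity)
    obtain ⟨N₁, hN'N, hNS, hcard⟩ := Set.Infinite.exists_superset_ncard_eq hSfin hN'.1
      N'.finite_toSet (k := 2 * N'.card) (by rw [Set.ncard_coe_finset]; omega)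
    have hN₁ : N₁.Finite := by
      by_contra hinf
      rw [Set.Infinite.ncard hinf] at hcard
      obtain ⟨U, hU⟩ := hSne
      obtain ⟨V, hV, -⟩ := hN'.2 U hU
      have := Finset.card_pos.mpr ⟨V, hV⟩
      omega
    have hcard' : hN₁.toFinset.card = 2 * N'.card := by
      rw [← Set.ncard_eq_toFinset_card N₁ hN₁, hcard]
    refine ⟨hN₁.toFinset, ⟨by rwa [Set.Finite.coe_toFinset], fun U hU => ?_⟩, ?_⟩
    · obtain ⟨V, hV, hUV⟩ := hN'.2 U hU
      exact ⟨V, hN₁.mem_toFinset.mpr (hN'N hV),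
        hUV.trans ((div_le_self hr'0.le hτ1).trans hr'r)⟩
    · have hα2 : α / 2 ∈ Set.Ioo (0 : ℝ) 1 := ⟨by linarith [hα.1], by linarith [hα.2]⟩
      have h := hnet (α / 2) hα2 r' hr'0 N' hN'
      rw [mul_div_cancel₀ α two_ne_zero] at h
      have e1 : 2 / (α / 2) * (N'.card : ℝ) = 2 / α * hN₁.toFinset.card := by
        rw [hcard']; push_cast; field_simp
      have e2 : Real.log (1 / (α / 2)) = Real.log 2 + Real.log (1 / α) := by
        rw [← Real.log_mul two_ne_zero (one_div_pos.mpr hα.1).ne']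
        congr 1; field_simp
      have e3 : (c₂ + 8 * MatrixCompletion.mLam Lam * c_xi * Real.log (1 / (α / 2))) * r' ≤
          (c₂ + 8 * MatrixCompletion.mLam Lam * c_xi * Real.log (1 / α)) * r := by
        have e4 : r = (1 + K) * r' := by rw [hr']; field_simp
        rw [e2, e4, ← mul_assoc, mul_add (8 * MatrixCompletion.mLam Lam * c_xi), hKc]
        refine mul_le_mul_of_nonneg_right ?_ hr'0.le
        have : 0 ≤ K * (8 * MatrixCompletion.mLam Lam * c_xi * Real.log (1 / α)) := by positivity
        linarith
      rw [e1] at h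
      exact (MatrixCompletion.measure_not_le_mono (add_le_add_right e3 _)).trans h
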